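/- Let $R>0$, $L_x,L_y>0$. Consider uniform internally heated convection at infinite Prandtl number in the layer $0\le z\le 1$: velocity $\mathbf u=(u,v,w)$, pressure $p$ and temperature $T$, all $L_x$-periodic in $x$ and $L_y$-periodic in $y$, and smooth for $t>0$ up to the plates, satisfy for $t>0$ $$\nabla\cdot\mathbf u=0,\qquad \nabla p=\Delta\mathbf u+R\,T\,\hat{\mathbf z},\qquad \partial_tT+\mathbf u\cdot\nabla T=\Delta T+1,$$ with isothermal no-slip plates, $\mathbf u=0$ and $T=0$ at $z=0$ and $z=1$. Write $$\langle f\rangle_h(z,t)=\frac1{L_xL_y}\int_0^{L_x}\!\!\int_0^{L_y}f\,dy\,dx,\qquad \langle f\rangle(t)=\int_0^1\langle f\rangle_h\,dz,\qquad \overline{g}=\limsup_{\tau\to\infty}\frac1\tau\int_0^\tau g(t)\,dt ,$$ where $g$ is $\langle wT\rangle$ or the bottom heat flux $\langle\partial_zT\rangle_h|_{z=0}$, both assumed integrable in $t$ near $t=0$, and let $\mathcal F_B=\overline{\langle\partial_zT\rangle_h|_{z=0}}$ be the mean heat flux out of the bottom plate. Put $$n_1=\tfrac1{12}\bigl(\tfrac{98}{9}(7-\sqrt{41})\bigr)^{1/3}\approx0.1555,\qquad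 n_3=2^{1/6}(12n_1)^{1/2}\approx1.5334,\qquad n_2=\tfrac{2^{1/6}}{3}n_3^{3/2}\approx0.7104 .$$ Then there is a constant $R_0>1$ (independent of $R$, $L_x$, $L_y$ and of the solution) such that for every $R>R_0$ one has $n_3R^{-1/3}<1$, and every such solution satisfies $$\mathcal F_B\ \ge\ n_1R^{-2/3}-n_2R^{-1/2}\ln\bigl(1-n_3R^{-1/3}\bigr)$$ and $$\overline{\langle wT\rangle}\ \le\ \tfrac12-n_1R^{-2/3}+n_2R^{-1/2}\ln\bigl(1-n_3R^{-1/3}\bigr).$$ -/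

import Mathlib

open scoped ContDiff

noncomputable section

namespace IHC

/-- A time-dependent scalar field `f t x y z` on the layer `z ∈ [0,1]`;
only its values for `t > 0` and `z ∈ [0,1]` matter. -/
abbrev ScalarField := ℝ → ℝ → ℝ → ℝ → ℝ

/-- The time derivative. -/
def dt (f : ScalarField) : ScalarField := fun t x y z => deriv (fun s => f s x y z) t

/-- The partial derivative in the horizontal variable `x`. -/
def dx (f : ScalarField) : ScalarField := fun t x y z => deriv (fun s => f t s y z) x

/-- The partial derivative in the horizontal variable `y`. -/
def dy (f : ScalarField) : ScalarField := fun t x y z => deriv (fun s => f t x s z) y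

/-- The partial derivative in the vertical variable `z ∈ [0,1]` (one-sided at the plates). -/
def dz (f : ScalarField) : ScalarField :=
  fun t x y z => derivWithin (fun s => f t x y s) (Set.Icc 0 1) z

/-- The spatial Laplacian. -/
def laplacian (f : ScalarField) : ScalarField :=
  fun t x y z => dx (dx f) t x y z + dy (dy f) t x y z + dz (dz f) t x y z

/-- `f` is smooth in `(t, x, y, z)` for `t > 0`, up to and including the plates. -/
def SmoothField (f : ScalarField) : Prop :=
  ContDiffOn ℝ ∞ (fun q : ℝ × ℝ × ℝ × ℝ => f q.1 q.2.1 q.2.2.1 q.2.2.2)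
    {q | 0 < q.1 ∧ q.2.2.2 ∈ Set.Icc (0 : ℝ) 1}

/-- `f` has period `Lx` in `x` and period `Ly` in `y`. -/
def HorizontallyPeriodic (Lx Ly : ℝ) (f : ScalarField) : Prop :=
  ∀ t x y z : ℝ, 0 < t → z ∈ Set.Icc (0 : ℝ) 1 →
    f t (x + Lx) y z = f t x y z ∧ f t x (y + Ly) z = f t x y z

/-- `f` vanishes on both plates `z = 0` and `z = 1`. -/
def VanishesOnPlates (f : ScalarField) : Prop :=
  ∀ t x y : ℝ, 0 < t → f t x y 0 = 0 ∧ f t x y 1 = 0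

/-- `(u, v, w)`, `p` and `T` are the velocity, pressure and temperature of a solution, for times
`t > 0`, of uniform internally heated convection at infinite Prandtl number with Rayleigh
number `R`, horizontal periods `Lx` and `Ly`, and isothermal no-slip plates. -/
structure IsNoSlipSolution (R Lx Ly : ℝ) (u v w p T : ScalarField) : Prop where
  smooth_u : SmoothField u
  smooth_v : SmoothField v
  smooth_w : SmoothField w
  smooth_p : SmoothField p
  smooth_T : SmoothField T
  periodic_u : HorizontallyPeriodic Lx Ly u
  periodic_v : HorizontallyPeriodic Lx Ly v
  periodic_w : HorizontallyPeriodic Lx Ly w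
  periodic_p : HorizontallyPeriodic Lx Ly p
  periodic_T : HorizontallyPeriodic Lx Ly T
  noSlip_u : VanishesOnPlates u
  noSlip_v : VanishesOnPlates v
  noSlip_w : VanishesOnPlates w
  isothermal : VanishesOnPlates T
  incompressible : ∀ t x y z : ℝ, 0 < t → z ∈ Set.Icc (0 : ℝ) 1 →
    dx u t x y z + dy v t x y z + dz w t x y z = 0
  momentum_x : ∀ t x y z : ℝ, 0 < t → z ∈ Set.Icc (0 : ℝ) 1 →
    dx p t x y z = laplacian u t x y z
  momentum_y : ∀ t x y z : ℝ, 0 < t → z ∈ Set.Icc (0 : ℝ) 1 →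
    dy p t x y z = laplacian v t x y z
  momentum_z : ∀ t x y z : ℝ, 0 < t → z ∈ Set.Icc (0 : ℝ) 1 →
    dz p t x y z = laplacian w t x y z + R * T t x y z
  heat : ∀ t x y z : ℝ, 0 < t → z ∈ Set.Icc (0 : ℝ) 1 →
    dt T t x y z + (u t x y z * dx T t x y z + v t x y z * dy T t x y z
      + w t x y z * dz T t x y z) = laplacian T t x y z + 1

/-- The average of `f` over the horizontal cross section at time `t` and height `z`. -/
def horAvg (Lx Ly : ℝ) (f : ScalarField) (t z : ℝ) : ℝ :=
  (1 / (Lx * Ly)) * ∫ x in (0 : ℝ)..Lx, ∫ y in (0 : ℝ)..Ly, f t x y z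

/-- The average of `f` over the layer at time `t`. -/
def volAvg (Lx Ly : ℝ) (f : ScalarField) (t : ℝ) : ℝ :=
  ∫ z in (0 : ℝ)..1, horAvg Lx Ly f t z

/-- The infinite-time average `limsup_{τ → ∞} (1/τ) ∫₀^τ g(t) dt`, an extended real number. -/
def timeMean (g : ℝ → ℝ) : EReal :=
  Filter.limsup (fun τ : ℝ => (((1 / τ) * ∫ t in (0 : ℝ)..τ, g t : ℝ) : EReal)) Filter.atTop

/-- The volume-averaged convective transport `⟨wT⟩` at time `t`. -/
def convectiveTransport (Lx Ly : ℝ) (w T : ScalarField) : ℝ → ℝ :=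
  volAvg Lx Ly (fun t x y z => w t x y z * T t x y z)

/-- The horizontally averaged heat flux `⟨∂_z T⟩_h` out of the bottom plate at time `t`. -/
def bottomFlux (Lx Ly : ℝ) (T : ScalarField) : ℝ → ℝ :=
  fun t => horAvg Lx Ly (dz T) t 0

/-- `n₁ ≈ 0.1555`. -/
def n₁ : ℝ := (1 / 12) * ((98 / 9) * (7 - √41)) ^ (1 / 3 : ℝ)

/-- `n₃ ≈ 1.5334`. -/
def n₃ : ℝ := (2 : ℝ) ^ (1 / 6 : ℝ) * (12 * n₁) ^ (1 / 2 : ℝ)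

/-- `n₂ ≈ 0.7104`. -/
def n₂ : ℝ := (2 : ℝ) ^ (1 / 6 : ℝ) / 3 * n₃ ^ (3 / 2 : ℝ)

/-- The lower bound `n₁ R^{-2/3} - n₂ R^{-1/2} ln (1 - n₃ R^{-1/3})`. -/
def fluxLowerBound (R : ℝ) : ℝ :=
  n₁ * R ^ (-(2 / 3) : ℝ)
    - n₂ * R ^ (-(1 / 2) : ℝ) * Real.log (1 - n₃ * R ^ (-(1 / 3) : ℝ))

end IHC

end

/-!
The flow enters through a lower bound on the heat flux out of the bottom plate. The temperature
equation is tested with a function `ψ(z)` that is convex, about one at the bottom plate and zero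
at the top plate (`profile`), with a boundary layer of width `δ = R^{-2/3}`. Up to a time derivative
the bottom flux is at least `⟨ψ⟩ + ⟨ψ' w T⟩ + ⟨ψ'' T⟩`. Here `⟨ψ⟩ ≈ δ / 2`, and the last term is
nonnegative because the temperature is nonnegative after some finite time: at a negative spatial
minimum the internal heating raises the temperature at rate at least one
(`IsHeated.lower_bound`). It remains to bound the convective term `⟨ψ' w T⟩`, which lives near the
bottom plate, by a small multiple of the dissipation `⟨|∇T|²⟩`, whose long-time mean is at most
`1/12` by the energy balance.

At infinite Prandtl number the velocity is slaved to the temperature: eliminating the pressure gives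
`Δ²w = -R (∂x² + ∂y²) T` with `w = ∂z w = 0` on the plates. Besides the energy identity, this
equation satisfies a Pohozaev identity, obtained by testing with `h(z) ∂z w`
(`IsBiharmonic.pohozaev`). For `h = z / (z + δ) - z / (1 + δ)`, which is bounded while
`h' ≈ 1 / δ` in the boundary layer, two Hardy inequalities turn it into
`δ ⟨(z + δ)^{-6} w²⟩ ≤ (8/25) R² ⟨|∇T|²⟩` (`IsBiharmonic.weighted_bound`). Together with the Hardy
inequality for `T` this gives `-⟨ψ' w T⟩ ≤ 3.42 R δ^{5/2} ⟨|∇T|²⟩`, so the mean bottom flux is at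
least `(1/2 - 3.42/12) R^{-2/3}` to leading order, that is `0.215 R^{-2/3}`. Since `n₁ < 1/5`, this
exceeds the claimed bound once `R` is large. The bound for `⟨wT⟩` follows, since
`⟨wT⟩ = 1/2 - (bottom flux)` up to a time derivative.

All identities are computed in the commutative ring of smooth periodic functions on the layer
(`LayerFunctions`), with its commuting derivations `∂t, ∂x, ∂y, ∂z` and the linear functional
`avg t`, which annihilates horizontal derivatives and the `∂z`-derivatives of functions vanishing
on the plates. Every integral identity is then an algebraic identity modulo divergences.
-/

open scoped ContDiff Pointwise

noncomputable section

namespace IHC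

variable {Lx Ly : ℝ}

/-! ### The differential algebra of smooth periodic functions on the layer -/

/-- Space-time `(t, x, y, z)`. -/
abbrev SpaceTime := ℝ × ℝ × ℝ × ℝ

/-- The closed layer `0 ≤ z ≤ 1` at positive times. -/
def layer : Set SpaceTime := {q | 0 < q.1 ∧ q.2.2.2 ∈ Set.Icc (0 : ℝ) 1}

open Classical in
/-- Extension by zero of a function on the layer to all of space-time. It only serves to speak of
derivatives within the layer. -/
def zeroExt (f : layer → ℝ) (q : SpaceTime) : ℝ := if h : q ∈ layer then f ⟨q, h⟩ else 0

lemma zeroExt_of_mem (f : layer → ℝ) {q : SpaceTime} (h : q ∈ layer) :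
    zeroExt f q = f ⟨q, h⟩ := dif_pos h

lemma zeroExt_of_notMem (f : layer → ℝ) {q : SpaceTime} (h : q ∉ layer) :
    zeroExt f q = 0 := dif_neg h

lemma layer_eq_prod : layer =
    (Set.Ioi (0 : ℝ)) ×ˢ ((Set.univ : Set ℝ) ×ˢ ((Set.univ : Set ℝ) ×ˢ (Set.Icc (0 : ℝ) 1))) := by
  ext q
  simp [layer]

lemma interior_layer : interior layer =
    (Set.Ioi (0 : ℝ)) ×ˢ ((Set.univ : Set ℝ) ×ˢ ((Set.univ : Set ℝ) ×ˢ (Set.Ioo (0 : ℝ) 1))) := by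
  rw [layer_eq_prod]
  simp [interior_prod_eq]

lemma uniqueDiffOn_layer : UniqueDiffOn ℝ layer := by
  rw [layer_eq_prod]
  exact (uniqueDiffOn_Ioi 0).prod (uniqueDiffOn_univ.prod
    (uniqueDiffOn_univ.prod (uniqueDiffOn_Icc zero_lt_one)))

lemma layer_subset_closure_interior : layer ⊆ closure (interior layer) := by
  rw [interior_layer, closure_prod_eq, closure_prod_eq, closure_prod_eq, layer_eq_prod,
    closure_Ioo zero_ne_one, closure_univ]
  exact Set.prod_mono_left subset_closure

lemma add_horizontal_mem_layer {a b : ℝ} {q : SpaceTime} :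
    q + (0, a, b, 0) ∈ layer ↔ q ∈ layer := by
  simp [layer]

lemma horizontal_vadd_layer (a b : ℝ) : ((0, a, b, 0) : SpaceTime) +ᵥ layer = layer := by
  ext q
  rw [Set.mem_vadd_set_iff_neg_vadd_mem]
  simp [layer]

/-- The smooth functions on the layer that have period `Lx` in `x` and `Ly` in `y`. Restricting
to the layer makes the equations and the rules of calculus true identities in a ring. -/
def LayerFunctions (Lx Ly : ℝ) : Subalgebra ℝ (layer → ℝ) where
  carrier := {f | ContDiffOn ℝ ∞ (zeroExt f) layer ∧
    (∀ q, zeroExt f (q + (0, Lx, 0, 0)) = zeroExt f q) ∧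
    (∀ q, zeroExt f (q + (0, 0, Ly, 0)) = zeroExt f q)}
  mul_mem' {f g} hf hg := by
    have h : zeroExt (f * g) = fun q => zeroExt f q * zeroExt g q := by
      ext q
      by_cases hq : q ∈ layer <;> simp [zeroExt, hq]
    refine ⟨h ▸ hf.1.mul hg.1, fun q => ?_, fun q => ?_⟩
    · simp only [h, hf.2.1 q, hg.2.1 q]
    · simp only [h, hf.2.2 q, hg.2.2 q]
  add_mem' {f g} hf hg := by
    have h : zeroExt (f + g) = fun q => zeroExt f q + zeroExt g q := by
      ext q
      by_cases hq : q ∈ layer <;> simp [zeroExt, hq]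
    refine ⟨h ▸ hf.1.add hg.1, fun q => ?_, fun q => ?_⟩
    · simp only [h, hf.2.1 q, hg.2.1 q]
    · simp only [h, hf.2.2 q, hg.2.2 q]
  algebraMap_mem' r := by
    refine ⟨(contDiffOn_const (c := r)).congr fun q hq => by simp [zeroExt, hq],
      fun q => ?_, fun q => ?_⟩ <;>
    · by_cases hq : q ∈ layer
      · rw [zeroExt_of_mem _ hq, zeroExt_of_mem _ (add_horizontal_mem_layer.2 hq)]
        rfl
      · rw [zeroExt_of_notMem _ hq, zeroExt_of_notMem _ (mt add_horizontal_mem_layer.1 hq)]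

lemma zeroExt_add (f g : LayerFunctions Lx Ly) :
    zeroExt (f + g : LayerFunctions Lx Ly) = zeroExt f + zeroExt g := by
  ext q
  by_cases hq : q ∈ layer <;> simp [zeroExt, hq]

lemma zeroExt_mul (f g : LayerFunctions Lx Ly) :
    zeroExt (f * g : LayerFunctions Lx Ly) = zeroExt f * zeroExt g := by
  ext q
  by_cases hq : q ∈ layer <;> simp [zeroExt, hq]

lemma zeroExt_smul (r : ℝ) (f : LayerFunctions Lx Ly) :
    zeroExt (r • f : LayerFunctions Lx Ly) = r • zeroExt f := by
  ext q
  by_cases hq : q ∈ layer <;> simp [zeroExt, hq]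

lemma contDiffOn_zeroExt (f : LayerFunctions Lx Ly) : ContDiffOn ℝ ∞ (zeroExt f) layer :=
  f.2.1

lemma differentiableWithinAt_zeroExt (f : LayerFunctions Lx Ly) {q : SpaceTime}
    (hq : q ∈ layer) : DifferentiableWithinAt ℝ (zeroExt f) layer q :=
  ((contDiffOn_zeroExt f).differentiableOn (by simp)) q hq

/-- The function underlying the derivative of `f` in the direction `v`. -/
def partialFun (v : SpaceTime) (f : LayerFunctions Lx Ly) (q : layer) : ℝ :=
  fderivWithin ℝ (zeroExt f) layer q v

lemma fderivWithin_zeroExt_add_horizontal (f : LayerFunctions Lx Ly) {a b : ℝ}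
    (h : ∀ q, zeroExt f (q + (0, a, b, 0)) = zeroExt f q) (q : SpaceTime) :
    fderivWithin ℝ (zeroExt f) layer (q + (0, a, b, 0)) = fderivWithin ℝ (zeroExt f) layer q := by
  have h1 := fderivWithin_comp_add_right (𝕜 := ℝ) (f := zeroExt f) (s := layer) (x := q)
    ((0, a, b, 0) : SpaceTime)
  rw [horizontal_vadd_layer] at h1
  rw [← h1]
  congr 1
  funext r
  exact h r

lemma partialFun_mem (v : SpaceTime) (f : LayerFunctions Lx Ly) :
    partialFun v f ∈ LayerFunctions Lx Ly := by
  refine ⟨?_, fun q => ?_, fun q => ?_⟩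
  · have h1 : ContDiffOn ℝ ∞ (fun q => fderivWithin ℝ (zeroExt f) layer q v) layer :=
      ((contDiffOn_zeroExt f).fderivWithin uniqueDiffOn_layer (by simp)).clm_apply contDiffOn_const
    exact h1.congr fun q hq => by rw [zeroExt_of_mem _ hq]; rfl
  · by_cases hq : q ∈ layer
    · rw [zeroExt_of_mem _ hq, zeroExt_of_mem _ (add_horizontal_mem_layer.2 hq)]
      simp only [partialFun]
      rw [fderivWithin_zeroExt_add_horizontal f f.2.2.1]
    · rw [zeroExt_of_notMem _ hq, zeroExt_of_notMem _ (mt add_horizontal_mem_layer.1 hq)]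
  · by_cases hq : q ∈ layer
    · rw [zeroExt_of_mem _ hq, zeroExt_of_mem _ (add_horizontal_mem_layer.2 hq)]
      simp only [partialFun]
      rw [fderivWithin_zeroExt_add_horizontal f f.2.2.2]
    · rw [zeroExt_of_notMem _ hq, zeroExt_of_notMem _ (mt add_horizontal_mem_layer.1 hq)]

/-- The derivative in the direction `v`, as a derivation of the algebra of smooth periodic
functions on the layer. -/
def partialD (v : SpaceTime) :
    Derivation ℝ (LayerFunctions Lx Ly) (LayerFunctions Lx Ly) :=
  Derivation.mk'
    { toFun := fun f => ⟨partialFun v f, partialFun_mem v f⟩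
      map_add' := fun f g => by
        ext q
        have h := fderivWithin_add (uniqueDiffOn_layer _ q.2) (differentiableWithinAt_zeroExt f q.2)
          (differentiableWithinAt_zeroExt g q.2)
        change partialFun v (f + g) q = partialFun v f q + partialFun v g q
        simp only [partialFun, zeroExt_add, h, add_apply]
      map_smul' := fun r f => by
        ext q
        have h := fderivWithin_const_smul (uniqueDiffOn_layer _ q.2)
          (differentiableWithinAt_zeroExt f q.2) r
        change partialFun v (r • f) q = r * partialFun v f q
        simp only [partialFun, zeroExt_smul, h, smul_apply, smul_eq_mul] }
    (fun f g => by
      ext q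
      have h := fderivWithin_mul (uniqueDiffOn_layer _ q.2) (differentiableWithinAt_zeroExt f q.2)
        (differentiableWithinAt_zeroExt g q.2)
      change partialFun v (f * g) q = f.1 q * partialFun v g q + g.1 q * partialFun v f q
      simp only [partialFun, zeroExt_mul, h, add_apply,
        smul_apply, smul_eq_mul, zeroExt_of_mem _ q.2])

lemma partialD_apply (v : SpaceTime) (f : LayerFunctions Lx Ly) (q : layer) :
    (partialD v f).1 q = fderivWithin ℝ (zeroExt f) layer q v := rfl

lemma partialD_comm (v v' : SpaceTime) (f : LayerFunctions Lx Ly) :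
    partialD v (partialD v' f) = partialD v' (partialD v f) := by
  have key : ∀ (v v' : SpaceTime) (q : layer), (partialD v (partialD v' f)).1 q =
      fderivWithin ℝ (fderivWithin ℝ (zeroExt f) layer) layer q v v' := by
    intro v v' q
    rw [partialD_apply]
    have h1 : ∀ r ∈ layer, zeroExt (partialD v' f : LayerFunctions Lx Ly) r =
        fderivWithin ℝ (zeroExt f) layer r v' := fun r hr => by
      rw [zeroExt_of_mem _ hr]; rfl
    rw [fderivWithin_congr h1 (h1 _ q.2)]
    have h2 : DifferentiableWithinAt ℝ (fderivWithin ℝ (zeroExt f) layer) layer q :=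
      (((contDiffOn_zeroExt f).fderivWithin (m := ∞) uniqueDiffOn_layer (by simp)).differentiableOn
        (by simp)) q q.2
    rw [fderivWithin_clm_apply (uniqueDiffOn_layer _ q.2) h2 (differentiableWithinAt_const v')]
    simp
  ext q
  rw [key, key]
  exact (contDiffOn_zeroExt f q q.2).isSymmSndFDerivWithinAt
    (by simpa using WithTop.coe_le_coe.2 (le_top : (2 : ℕ∞) ≤ ⊤)) uniqueDiffOn_layer
    (layer_subset_closure_interior q.2) q.2 v v'

/-- `∂/∂t`. -/
abbrev Dt : Derivation ℝ (LayerFunctions Lx Ly) (LayerFunctions Lx Ly) := partialD (1, 0, 0, 0)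
/-- `∂/∂x`. -/
abbrev Dx : Derivation ℝ (LayerFunctions Lx Ly) (LayerFunctions Lx Ly) := partialD (0, 1, 0, 0)
/-- `∂/∂y`. -/
abbrev Dy : Derivation ℝ (LayerFunctions Lx Ly) (LayerFunctions Lx Ly) := partialD (0, 0, 1, 0)
/-- `∂/∂z`. -/
abbrev Dz : Derivation ℝ (LayerFunctions Lx Ly) (LayerFunctions Lx Ly) := partialD (0, 0, 0, 1)

/-- The derivative of `f` along a curve in the layer. -/
lemma hasDerivWithinAt_along (f : LayerFunctions Lx Ly) {γ : ℝ → SpaceTime} {v : SpaceTime}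
    {I : Set ℝ} {s : ℝ} (hs : s ∈ I) (hγ : HasDerivWithinAt γ v I s)
    (hI : ∀ r ∈ I, γ r ∈ layer) :
    HasDerivWithinAt (fun r => zeroExt f (γ r)) ((partialD v f).1 ⟨γ s, hI s hs⟩) I s := by
  rw [partialD_apply]
  exact (differentiableWithinAt_zeroExt f (hI s hs)).hasFDerivWithinAt.comp_hasDerivWithinAt s hγ hI

lemma hasDerivAt_x (f : LayerFunctions Lx Ly) {t x y z : ℝ} (h : (t, x, y, z) ∈ layer) :
    HasDerivAt (fun s => zeroExt f (t, s, y, z))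
      (zeroExt (Dx f : LayerFunctions Lx Ly) (t, x, y, z)) x := by
  rw [zeroExt_of_mem _ h, ← hasDerivWithinAt_univ]
  have hγ : HasDerivAt (fun s : ℝ => ((t, s, y, z) : SpaceTime)) (0, 1, 0, 0) x :=
    (hasDerivAt_const x t).prodMk ((hasDerivAt_id x).prodMk (hasDerivAt_const x (y, z)))
  exact hasDerivWithinAt_along f (Set.mem_univ x) hγ.hasDerivWithinAt (fun r _ => h)

lemma hasDerivAt_y (f : LayerFunctions Lx Ly) {t x y z : ℝ} (h : (t, x, y, z) ∈ layer) :
    HasDerivAt (fun s => zeroExt f (t, x, s, z))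
      (zeroExt (Dy f : LayerFunctions Lx Ly) (t, x, y, z)) y := by
  rw [zeroExt_of_mem _ h, ← hasDerivWithinAt_univ]
  have hγ : HasDerivAt (fun s : ℝ => ((t, x, s, z) : SpaceTime)) (0, 0, 1, 0) y :=
    (hasDerivAt_const y t).prodMk ((hasDerivAt_const y x).prodMk
      ((hasDerivAt_id y).prodMk (hasDerivAt_const y z)))
  exact hasDerivWithinAt_along f (Set.mem_univ y) hγ.hasDerivWithinAt (fun r _ => h)

lemma hasDerivWithinAt_z (f : LayerFunctions Lx Ly) {t x y z : ℝ} (h : (t, x, y, z) ∈ layer) :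
    HasDerivWithinAt (fun s => zeroExt f (t, x, y, s))
      (zeroExt (Dz f : LayerFunctions Lx Ly) (t, x, y, z)) (Set.Icc 0 1) z := by
  rw [zeroExt_of_mem _ h]
  have hγ : HasDerivAt (fun s : ℝ => ((t, x, y, s) : SpaceTime)) (0, 0, 0, 1) z :=
    (hasDerivAt_const z t).prodMk ((hasDerivAt_const z x).prodMk
      ((hasDerivAt_const z y).prodMk (hasDerivAt_id z)))
  exact hasDerivWithinAt_along f h.2 hγ.hasDerivWithinAt (fun r hr => ⟨h.1, hr⟩)

lemma hasDerivAt_t (f : LayerFunctions Lx Ly) {t x y z : ℝ} (h : (t, x, y, z) ∈ layer) :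
    HasDerivAt (fun s => zeroExt f (s, x, y, z))
      (zeroExt (Dt f : LayerFunctions Lx Ly) (t, x, y, z)) t := by
  rw [zeroExt_of_mem _ h]
  have hγ : HasDerivAt (fun s : ℝ => ((s, x, y, z) : SpaceTime)) (1, 0, 0, 0) t :=
    (hasDerivAt_id t).prodMk (hasDerivAt_const t (x, y, z))
  have ht : t ∈ Set.Ioi (0 : ℝ) := h.1
  exact (hasDerivWithinAt_along f ht hγ.hasDerivWithinAt
    (fun r hr => ⟨hr, h.2⟩)).hasDerivAt (Ioi_mem_nhds ht)

/-- The scalar field `f` and the layer function `F` agree on the layer. -/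
def Represents (F : LayerFunctions Lx Ly) (f : ScalarField) : Prop :=
  ∀ t x y z : ℝ, (t, x, y, z) ∈ layer → f t x y z = zeroExt F (t, x, y, z)

lemma exists_represents {f : ScalarField} (hf : SmoothField f)
    (hp : HorizontallyPeriodic Lx Ly f) : ∃ F : LayerFunctions Lx Ly, Represents F f := by
  let F : layer → ℝ := fun q => f q.1.1 q.1.2.1 q.1.2.2.1 q.1.2.2.2
  refine ⟨⟨F, ContDiffOn.congr hf fun q hq => zeroExt_of_mem F hq, fun q => ?_, fun q => ?_⟩,
    fun t x y z h => (zeroExt_of_mem F h).symm⟩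
  · by_cases hq : q ∈ layer
    · rw [zeroExt_of_mem _ hq, zeroExt_of_mem _ (add_horizontal_mem_layer.2 hq)]
      simpa [F] using (hp q.1 q.2.1 q.2.2.1 q.2.2.2 hq.1 hq.2).1
    · rw [zeroExt_of_notMem _ hq, zeroExt_of_notMem _ (mt add_horizontal_mem_layer.1 hq)]
  · by_cases hq : q ∈ layer
    · rw [zeroExt_of_mem _ hq, zeroExt_of_mem _ (add_horizontal_mem_layer.2 hq)]
      simpa [F] using (hp q.1 q.2.1 q.2.2.1 q.2.2.2 hq.1 hq.2).2
    · rw [zeroExt_of_notMem _ hq, zeroExt_of_notMem _ (mt add_horizontal_mem_layer.1 hq)]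

namespace Represents

variable {F : LayerFunctions Lx Ly} {f : ScalarField}

lemma dx (h : Represents F f) : Represents (Dx F) (dx f) := by
  intro t x y z hq
  have : (fun s => f t s y z) = fun s => zeroExt F (t, s, y, z) :=
    funext fun s => h t s y z hq
  rw [IHC.dx, this]
  exact (hasDerivAt_x F hq).deriv

lemma dy (h : Represents F f) : Represents (Dy F) (dy f) := by
  intro t x y z hq
  have : (fun s => f t x s z) = fun s => zeroExt F (t, x, s, z) :=
    funext fun s => h t x s z hq
  rw [IHC.dy, this]
  exact (hasDerivAt_y F hq).deriv

lemma dz (h : Represents F f) : Represents (Dz F) (dz f) := by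
  intro t x y z hq
  have : Set.EqOn (fun s => f t x y s) (fun s => zeroExt F (t, x, y, s)) (Set.Icc 0 1) :=
    fun s hs => h t x y s ⟨hq.1, hs⟩
  rw [IHC.dz, derivWithin_congr this (this hq.2)]
  exact (hasDerivWithinAt_z F hq).derivWithin (uniqueDiffOn_Icc zero_lt_one z hq.2)

lemma dt (h : Represents F f) : Represents (Dt F) (dt f) := by
  intro t x y z hq
  have : (fun s => f s x y z) =ᶠ[nhds t] fun s => zeroExt F (s, x, y, z) :=
    Filter.eventually_of_mem (Ioi_mem_nhds hq.1) fun s hs => h s x y z ⟨hs, hq.2⟩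
  rw [IHC.dt, this.deriv_eq]
  exact (hasDerivAt_t F hq).deriv

lemma laplacian (h : Represents F f) :
    Represents (Dx (Dx F) + Dy (Dy F) + Dz (Dz F)) (laplacian f) := by
  intro t x y z hq
  rw [IHC.laplacian, h.dx.dx t x y z hq, h.dy.dy t x y z hq, h.dz.dz t x y z hq]
  simp only [zeroExt_add, Pi.add_apply]

end Represents

/-! ### Averages over the layer -/

/-- The layer function `F` composed with the retraction of space-time onto the part `t ≥ a` of
the layer. For `a > 0` this is continuous on all of space-time. -/
def clampedExt (a : ℝ) (F : LayerFunctions Lx Ly) (q : SpaceTime) : ℝ :=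
  zeroExt F (max a q.1, q.2.1, q.2.2.1, (Set.projIcc (0 : ℝ) 1 zero_le_one q.2.2.2 : ℝ))

lemma clampedExt_eq (F : LayerFunctions Lx Ly) {a t x y z : ℝ} (ht : a ≤ t)
    (hz : z ∈ Set.Icc (0 : ℝ) 1) : clampedExt a F (t, x, y, z) = zeroExt F (t, x, y, z) := by
  simp only [clampedExt, max_eq_right ht, Set.projIcc_of_mem zero_le_one hz]

lemma continuous_clampedExt {a : ℝ} (ha : 0 < a) (F : LayerFunctions Lx Ly) :
    Continuous (clampedExt a F) := by
  refine (contDiffOn_zeroExt F).continuousOn.comp_continuous (f := fun q : SpaceTime =>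
    ((max a q.1, q.2.1, q.2.2.1,
      (Set.projIcc (0 : ℝ) 1 zero_le_one q.2.2.2 : ℝ)) : SpaceTime)) ?_ ?_
  · have h := continuous_projIcc (α := ℝ) (a := 0) (b := 1) (h := zero_le_one)
    fun_prop
  · exact fun q => ⟨lt_max_of_lt_left ha, (Set.projIcc (0 : ℝ) 1 zero_le_one q.2.2.2).2⟩

lemma integral_swap_of_continuous {G : ℝ → ℝ → ℝ} (hG : Continuous G.uncurry) (a b c d : ℝ) :
    ∫ x in a..b, ∫ y in c..d, G x y = ∫ y in c..d, ∫ x in a..b, G x y := by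
  apply MeasureTheory.intervalIntegral_intervalIntegral_swap
  refine (hG.continuousOn.integrableOn_compact (isCompact_uIcc (a := a) (b := b) |>.prod
    (isCompact_uIcc (a := c) (b := d)))).mono_set ?_
  exact Set.prod_mono Set.uIoc_subset_uIcc Set.uIoc_subset_uIcc

/-- The average of a layer function over the horizontal cross section at time `t`, height `z`. -/
def hmean (F : LayerFunctions Lx Ly) (t z : ℝ) : ℝ :=
  horAvg Lx Ly (fun t x y z => zeroExt F (t, x, y, z)) t z

/-- The average of a layer function over the layer at time `t`. -/
def mean (t : ℝ) (F : LayerFunctions Lx Ly) : ℝ := ∫ z in (0 : ℝ)..1, hmean F t z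

lemma hmean_eq_clamped (F : LayerFunctions Lx Ly) {a t z : ℝ} (ht : a ≤ t)
    (hz : z ∈ Set.Icc (0 : ℝ) 1) : hmean F t z =
      (1 / (Lx * Ly)) * ∫ x in (0 : ℝ)..Lx, ∫ y in (0 : ℝ)..Ly, clampedExt a F (t, x, y, z) := by
  simp only [hmean, horAvg, clampedExt_eq F ht hz]

lemma mean_eq_clamped (F : LayerFunctions Lx Ly) {a t : ℝ} (ht : a ≤ t) : mean t F =
    (1 / (Lx * Ly)) * ∫ z in (0 : ℝ)..1, ∫ x in (0 : ℝ)..Lx, ∫ y in (0 : ℝ)..Ly,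
      clampedExt a F (t, x, y, z) := by
  rw [← intervalIntegral.integral_const_mul]
  refine intervalIntegral.integral_congr fun z hz => ?_
  rw [Set.uIcc_of_le zero_le_one] at hz
  exact hmean_eq_clamped F ht hz

lemma continuous_clampedExt_integral {a : ℝ} (ha : 0 < a) (F : LayerFunctions Lx Ly) :
    Continuous fun p : ℝ × ℝ => ∫ x in (0 : ℝ)..Lx, ∫ y in (0 : ℝ)..Ly,
      clampedExt a F (p.1, x, y, p.2) := by
  have h := continuous_clampedExt ha F
  refine intervalIntegral.continuous_parametric_intervalIntegral_of_continuous' ?_ _ _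
  refine intervalIntegral.continuous_parametric_intervalIntegral_of_continuous'
    (f := fun (q : (ℝ × ℝ) × ℝ) y => clampedExt a F (q.1.1, q.2, y, q.1.2)) ?_ _ _
  simp only [Function.uncurry_def]
  fun_prop

lemma hmean_of_nonpos (F : LayerFunctions Lx Ly) {t : ℝ} (ht : t ≤ 0) (z : ℝ) :
    hmean F t z = 0 := by
  have h : ∀ x y, zeroExt F (t, x, y, z) = 0 := fun x y =>
    zeroExt_of_notMem _ fun h => absurd h.1 (not_lt.2 ht)
  simp [hmean, horAvg, h]

lemma hmean_add (F G : LayerFunctions Lx Ly) (t : ℝ) {z : ℝ} (hz : z ∈ Set.Icc (0 : ℝ) 1) :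
    hmean (F + G) t z = hmean F t z + hmean G t z := by
  rcases le_or_gt t 0 with ht | ht
  · simp [hmean_of_nonpos _ ht]
  simp only [hmean_eq_clamped (a := t) _ le_rfl hz]
  have hF := continuous_clampedExt ht F
  have hG := continuous_clampedExt ht G
  have h : ∀ x y, clampedExt t (F + G) (t, x, y, z) =
      clampedExt t F (t, x, y, z) + clampedExt t G (t, x, y, z) := fun x y => by
    simp only [clampedExt, zeroExt_add, Pi.add_apply]
  simp only [h]
  have h1 : ∀ x, ∫ y in (0 : ℝ)..Ly, (clampedExt t F (t, x, y, z) + clampedExt t G (t, x, y, z))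
      = (∫ y in (0 : ℝ)..Ly, clampedExt t F (t, x, y, z)) +
        ∫ y in (0 : ℝ)..Ly, clampedExt t G (t, x, y, z) := fun x =>
    intervalIntegral.integral_add (Continuous.intervalIntegrable (by fun_prop) _ _)
      (Continuous.intervalIntegrable (by fun_prop) _ _)
  have h2 : ∀ H : LayerFunctions Lx Ly, Continuous fun x => ∫ y in (0 : ℝ)..Ly,
      clampedExt t H (t, x, y, z) := fun H => by
    have := continuous_clampedExt ht H
    refine intervalIntegral.continuous_parametric_intervalIntegral_of_continuous' ?_ _ _
    simp only [Function.uncurry_def]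
    fun_prop
  simp only [h1]
  rw [intervalIntegral.integral_add ((h2 F).intervalIntegrable _ _)
    ((h2 G).intervalIntegrable _ _), mul_add]

lemma hmean_smul (r : ℝ) (F : LayerFunctions Lx Ly) (t z : ℝ) :
    hmean (r • F) t z = r * hmean F t z := by
  simp only [hmean, horAvg, zeroExt_smul, Pi.smul_apply, smul_eq_mul,
    intervalIntegral.integral_const_mul]
  ring

lemma continuousOn_hmean (F : LayerFunctions Lx Ly) (t : ℝ) :
    ContinuousOn (hmean F t) (Set.Icc 0 1) := by
  rcases le_or_gt t 0 with ht | ht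
  · exact continuousOn_const.congr fun z _ => hmean_of_nonpos F ht z
  · refine ContinuousOn.congr (f := fun z => (1 / (Lx * Ly)) * ∫ x in (0 : ℝ)..Lx,
      ∫ y in (0 : ℝ)..Ly, clampedExt t F (t, x, y, z)) ?_
      fun z hz => hmean_eq_clamped (a := t) F le_rfl hz
    have := (continuous_clampedExt_integral ht F).comp (Continuous.prodMk_right t)
    exact (continuous_const.mul this).continuousOn

lemma intervalIntegrable_hmean (F : LayerFunctions Lx Ly) (t : ℝ) :
    IntervalIntegrable (hmean F t) MeasureTheory.volume 0 1 :=
  ContinuousOn.intervalIntegrable (by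
    rw [Set.uIcc_of_le zero_le_one]; exact continuousOn_hmean F t)

/-- The average over the layer as a linear functional. -/
def avg (t : ℝ) : LayerFunctions Lx Ly →ₗ[ℝ] ℝ where
  toFun := mean t
  map_add' F G := by
    rw [mean, mean, mean, ← intervalIntegral.integral_add (intervalIntegrable_hmean F t)
      (intervalIntegrable_hmean G t)]
    refine intervalIntegral.integral_congr fun z hz => ?_
    rw [Set.uIcc_of_le zero_le_one] at hz
    exact hmean_add F G t hz
  map_smul' r F := by
    simp only [mean, hmean_smul, intervalIntegral.integral_const_mul, RingHom.id_apply,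
      smul_eq_mul]

lemma avg_apply (t : ℝ) (F : LayerFunctions Lx Ly) :
    avg t F = ∫ z in (0 : ℝ)..1, hmean F t z := rfl

lemma continuousOn_avg (F : LayerFunctions Lx Ly) :
    ContinuousOn (fun t => avg t F) (Set.Ioi 0) := by
  have h : ∀ a : ℝ, 0 < a → ContinuousOn (fun t => avg t F) (Set.Ici a) := by
    intro a ha
    refine ContinuousOn.congr (f := fun t => (1 / (Lx * Ly)) * ∫ z in (0 : ℝ)..1,
      ∫ x in (0 : ℝ)..Lx, ∫ y in (0 : ℝ)..Ly, clampedExt a F (t, x, y, z)) ?_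
      fun t ht => mean_eq_clamped F ht
    refine (continuous_const.mul ?_).continuousOn
    exact intervalIntegral.continuous_parametric_intervalIntegral_of_continuous'
      (f := fun t z => ∫ x in (0 : ℝ)..Lx, ∫ y in (0 : ℝ)..Ly, clampedExt a F (t, x, y, z))
      (continuous_clampedExt_integral ha F) _ _
  intro t ht
  have ht' : (0 : ℝ) < t := ht
  exact ((h (t / 2) (by positivity)).continuousAt (Ici_mem_nhds (by linarith))).continuousWithinAt

lemma continuousOn_hmean_time (F : LayerFunctions Lx Ly) {z : ℝ} (hz : z ∈ Set.Icc (0 : ℝ) 1) :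
    ContinuousOn (fun t => hmean F t z) (Set.Ioi 0) := by
  have h : ∀ a : ℝ, 0 < a → ContinuousOn (fun t => hmean F t z) (Set.Ici a) := by
    intro a ha
    refine ContinuousOn.congr (f := fun t => (1 / (Lx * Ly)) *
      ∫ x in (0 : ℝ)..Lx, ∫ y in (0 : ℝ)..Ly, clampedExt a F (t, x, y, z)) ?_
      fun t ht => hmean_eq_clamped F ht hz
    exact (continuous_const.mul ((continuous_clampedExt_integral ha F).comp
      (Continuous.prodMk_left z))).continuousOn
  intro t ht
  have ht' : (0 : ℝ) < t := ht
  exact ((h (t / 2) (by positivity)).continuousAt (Ici_mem_nhds (by linarith))).continuousWithinAt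

lemma avg_of_nonpos (F : LayerFunctions Lx Ly) {t : ℝ} (ht : t ≤ 0) : avg t F = 0 := by
  simp [avg_apply, hmean_of_nonpos F ht]

lemma avg_Dx (t : ℝ) (F : LayerFunctions Lx Ly) : avg t (Dx F) = 0 := by
  rcases le_or_gt t 0 with ht | ht
  · exact avg_of_nonpos _ ht
  rw [avg_apply, intervalIntegral.integral_congr (g := fun _ => (0 : ℝ)),
    intervalIntegral.integral_zero]
  intro z hz
  rw [Set.uIcc_of_le zero_le_one] at hz
  have hc := continuous_clampedExt ht (Dx F : LayerFunctions Lx Ly)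
  beta_reduce
  rw [hmean_eq_clamped (a := t) _ le_rfl hz, integral_swap_of_continuous (by
    simp only [Function.uncurry_def]; fun_prop)]
  have h : ∀ y, ∫ x in (0 : ℝ)..Lx,
      clampedExt t (Dx F : LayerFunctions Lx Ly) (t, x, y, z) = 0 := by
    intro y
    rw [intervalIntegral.integral_eq_sub_of_hasDerivAt (f := fun x => zeroExt F (t, x, y, z))
      (fun x _ => ?_) (Continuous.intervalIntegrable (by fun_prop) _ _)]
    · have := F.2.2.1 (t, 0, y, z)
      simp only [Prod.mk_add_mk, zero_add, add_zero] at this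
      rw [this, sub_self]
    · rw [clampedExt_eq _ le_rfl hz]
      exact hasDerivAt_x F ⟨ht, hz⟩
  simp [h]

lemma avg_Dy (t : ℝ) (F : LayerFunctions Lx Ly) : avg t (Dy F) = 0 := by
  rcases le_or_gt t 0 with ht | ht
  · exact avg_of_nonpos _ ht
  rw [avg_apply, intervalIntegral.integral_congr (g := fun _ => (0 : ℝ)),
    intervalIntegral.integral_zero]
  intro z hz
  rw [Set.uIcc_of_le zero_le_one] at hz
  have hc := continuous_clampedExt ht (Dy F : LayerFunctions Lx Ly)
  beta_reduce
  rw [hmean_eq_clamped (a := t) _ le_rfl hz]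
  have h : ∀ x, ∫ y in (0 : ℝ)..Ly,
      clampedExt t (Dy F : LayerFunctions Lx Ly) (t, x, y, z) = 0 := by
    intro x
    rw [intervalIntegral.integral_eq_sub_of_hasDerivAt (f := fun y => zeroExt F (t, x, y, z))
      (fun y _ => ?_) (Continuous.intervalIntegrable (by fun_prop) _ _)]
    · have := F.2.2.2 (t, x, 0, z)
      simp only [Prod.mk_add_mk, zero_add, add_zero] at this
      rw [this, sub_self]
    · rw [clampedExt_eq _ le_rfl hz]
      exact hasDerivAt_y F ⟨ht, hz⟩
  simp [h]

lemma integral_Dz (F : LayerFunctions Lx Ly) {t : ℝ} (ht : 0 < t) (x y : ℝ) :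
    ∫ z in (0 : ℝ)..1, clampedExt t (Dz F : LayerFunctions Lx Ly) (t, x, y, z) =
      clampedExt t F (t, x, y, 1) - clampedExt t F (t, x, y, 0) := by
  have hc := continuous_clampedExt ht (Dz F : LayerFunctions Lx Ly)
  have hF := continuous_clampedExt ht F
  refine intervalIntegral.integral_eq_sub_of_hasDerivAt_of_le
    (f := fun z => clampedExt t F (t, x, y, z)) zero_le_one
    (Continuous.continuousOn (by fun_prop)) (fun z hz => ?_)
    (Continuous.intervalIntegrable (by fun_prop) _ _)
  have hz' := Set.Ioo_subset_Icc_self hz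
  rw [clampedExt_eq _ le_rfl hz']
  refine ((hasDerivWithinAt_z F (x := x) (y := y) ⟨ht, hz'⟩).congr (fun s hs => ?_)
    ?_).hasDerivAt (Icc_mem_nhds hz.1 hz.2)
  · exact clampedExt_eq F le_rfl hs
  · exact clampedExt_eq F le_rfl hz'

lemma avg_Dz (t : ℝ) (F : LayerFunctions Lx Ly) :
    avg t (Dz F) = hmean F t 1 - hmean F t 0 := by
  rcases le_or_gt t 0 with ht | ht
  · simp [avg_of_nonpos _ ht, hmean_of_nonpos _ ht]
  have hc := continuous_clampedExt ht (Dz F : LayerFunctions Lx Ly)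
  have hF := continuous_clampedExt ht F
  have h0 : (0 : ℝ) ∈ Set.Icc (0 : ℝ) 1 := by simp
  have h1 : (1 : ℝ) ∈ Set.Icc (0 : ℝ) 1 := by simp
  rw [hmean_eq_clamped (a := t) _ le_rfl h0, hmean_eq_clamped (a := t) _ le_rfl h1]
  change mean t (Dz F) = _
  rw [mean_eq_clamped (a := t) _ le_rfl, ← mul_sub]
  congr 1
  have key : ∀ s : ℝ, Continuous fun x => ∫ y in (0 : ℝ)..Ly, clampedExt t F (t, x, y, s) :=
    fun s => intervalIntegral.continuous_parametric_intervalIntegral_of_continuous'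
      (f := fun x y => clampedExt t F (t, x, y, s))
      (by simp only [Function.uncurry_def]; fun_prop) _ _
  rw [← intervalIntegral.integral_sub ((key 1).intervalIntegrable _ _)
    ((key 0).intervalIntegrable _ _), integral_swap_of_continuous]
  · refine intervalIntegral.integral_congr fun x _ => ?_
    rw [integral_swap_of_continuous (by simp only [Function.uncurry_def]; fun_prop),
      ← intervalIntegral.integral_sub (Continuous.intervalIntegrable (by fun_prop) _ _)
        (Continuous.intervalIntegrable (by fun_prop) _ _)]
    exact intervalIntegral.integral_congr fun y _ => integral_Dz F ht x y
  · refine intervalIntegral.continuous_parametric_intervalIntegral_of_continuous'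
      (f := fun (q : ℝ × ℝ) y => clampedExt t (Dz F : LayerFunctions Lx Ly) (t, q.2, y, q.1)) ?_ _ _
    simp only [Function.uncurry_def]
    fun_prop

lemma integral_avg_Dt (F : LayerFunctions Lx Ly) {a b : ℝ} (ha : 0 < a) (hab : a ≤ b) :
    ∫ t in a..b, avg t (Dt F) = avg b F - avg a F := by
  have hc := continuous_clampedExt ha (Dt F : LayerFunctions Lx Ly)
  have hF := continuous_clampedExt ha F
  have e1 : ∫ t in a..b, avg t (Dt F : LayerFunctions Lx Ly) =
      ∫ t in a..b, (1 / (Lx * Ly)) * ∫ z in (0 : ℝ)..1, ∫ x in (0 : ℝ)..Lx, ∫ y in (0 : ℝ)..Ly,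
        clampedExt a (Dt F : LayerFunctions Lx Ly) (t, x, y, z) := by
    refine intervalIntegral.integral_congr fun t ht => ?_
    rw [Set.uIcc_of_le hab] at ht
    exact mean_eq_clamped _ ht.1
  have e2 : ∀ s, a ≤ s → avg s F = (1 / (Lx * Ly)) * ∫ z in (0 : ℝ)..1, ∫ x in (0 : ℝ)..Lx,
      ∫ y in (0 : ℝ)..Ly, clampedExt a F (s, x, y, z) := fun s hs => mean_eq_clamped _ hs
  rw [e1, e2 b hab, e2 a le_rfl, intervalIntegral.integral_const_mul, ← mul_sub]
  congr 1
  have k2 : ∀ s z : ℝ, Continuous fun x => ∫ y in (0 : ℝ)..Ly, clampedExt a F (s, x, y, z) :=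
    fun s z => intervalIntegral.continuous_parametric_intervalIntegral_of_continuous'
      (f := fun x y => clampedExt a F (s, x, y, z))
      (by simp only [Function.uncurry_def]; fun_prop) _ _
  have k3 : ∀ s : ℝ, Continuous fun z => ∫ x in (0 : ℝ)..Lx, ∫ y in (0 : ℝ)..Ly,
      clampedExt a F (s, x, y, z) :=
    fun s => (continuous_clampedExt_integral ha F).comp (Continuous.prodMk_right s)
  rw [← intervalIntegral.integral_sub ((k3 b).intervalIntegrable _ _)
    ((k3 a).intervalIntegrable _ _), integral_swap_of_continuous
    (G := fun t z => ∫ x in (0 : ℝ)..Lx, ∫ y in (0 : ℝ)..Ly,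
      clampedExt a (Dt F : LayerFunctions Lx Ly) (t, x, y, z))
    (continuous_clampedExt_integral ha (Dt F : LayerFunctions Lx Ly))]
  refine intervalIntegral.integral_congr fun z hz => ?_
  rw [Set.uIcc_of_le zero_le_one] at hz
  rw [← intervalIntegral.integral_sub ((k2 b z).intervalIntegrable _ _)
    ((k2 a z).intervalIntegrable _ _), integral_swap_of_continuous]
  · refine intervalIntegral.integral_congr fun x _ => ?_
    rw [integral_swap_of_continuous (by simp only [Function.uncurry_def]; fun_prop),
      ← intervalIntegral.integral_sub (Continuous.intervalIntegrable (by fun_prop) _ _)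
        (Continuous.intervalIntegrable (by fun_prop) _ _)]
    refine intervalIntegral.integral_congr fun y _ => ?_
    rw [clampedExt_eq F hab hz, clampedExt_eq F le_rfl hz]
    refine intervalIntegral.integral_eq_sub_of_hasDerivAt
      (f := fun t => zeroExt F (t, x, y, z)) (fun t ht => ?_)
      (Continuous.intervalIntegrable (by fun_prop) _ _)
    rw [Set.uIcc_of_le hab] at ht
    rw [clampedExt_eq _ ht.1 hz]
    exact hasDerivAt_t F ⟨ha.trans_le ht.1, hz⟩
  · refine intervalIntegral.continuous_parametric_intervalIntegral_of_continuous'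
      (f := fun (q : ℝ × ℝ) y => clampedExt a (Dt F : LayerFunctions Lx Ly) (q.1, q.2, y, z)) ?_ _ _
    simp only [Function.uncurry_def]
    fun_prop

lemma hmean_congr {F G : LayerFunctions Lx Ly} {t z : ℝ}
    (h : ∀ x y, zeroExt F (t, x, y, z) = zeroExt G (t, x, y, z)) : hmean F t z = hmean G t z := by
  simp only [hmean, horAvg, h]

section positivity

variable [hLx : Fact (0 < Lx)] [hLy : Fact (0 < Ly)]

lemma hmean_nonneg {F : LayerFunctions Lx Ly} {t z : ℝ}
    (h : ∀ x y, 0 ≤ zeroExt F (t, x, y, z)) : 0 ≤ hmean F t z := by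
  have h1 := hLx.out
  have h2 := hLy.out
  refine mul_nonneg (by positivity) ?_
  exact intervalIntegral.integral_nonneg h1.le fun x _ =>
    intervalIntegral.integral_nonneg h2.le fun y _ => h x y

lemma avg_nonneg {F : LayerFunctions Lx Ly} {t : ℝ}
    (h : ∀ q : layer, q.1.1 = t → 0 ≤ F.1 q) : 0 ≤ avg t F := by
  refine intervalIntegral.integral_nonneg zero_le_one fun z _ => hmean_nonneg fun x y => ?_
  by_cases hq : (t, x, y, z) ∈ layer
  · rw [zeroExt_of_mem _ hq]
    exact h _ rfl
  · rw [zeroExt_of_notMem _ hq]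

lemma avg_mono {F G : LayerFunctions Lx Ly} {t : ℝ}
    (h : ∀ q : layer, q.1.1 = t → F.1 q ≤ G.1 q) : avg t F ≤ avg t G := by
  rw [← sub_nonneg, ← map_sub]
  exact avg_nonneg fun q hq => sub_nonneg.2 (h q hq)

lemma avg_sq_nonneg (t : ℝ) (F : LayerFunctions Lx Ly) : 0 ≤ avg t (F ^ 2) :=
  avg_nonneg fun q _ => sq_nonneg (F.1 q)

lemma hmean_algebraMap (r : ℝ) {t z : ℝ} (ht : 0 < t) (hz : z ∈ Set.Icc (0 : ℝ) 1) :
    hmean (algebraMap ℝ (LayerFunctions Lx Ly) r) t z = r := by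
  have h1 := hLx.out.ne'
  have h2 := hLy.out.ne'
  have h : ∀ x y, zeroExt (algebraMap ℝ (LayerFunctions Lx Ly) r) (t, x, y, z) = r := by
    intro x y
    rw [zeroExt_of_mem _ ⟨ht, hz⟩]
    rfl
  simp only [hmean, horAvg, h, intervalIntegral.integral_const, smul_eq_mul, sub_zero]
  field_simp

lemma avg_algebraMap (r : ℝ) {t : ℝ} (ht : 0 < t) :
    avg t (algebraMap ℝ (LayerFunctions Lx Ly) r) = r := by
  rw [avg_apply, intervalIntegral.integral_congr (g := fun _ => r)]
  · simp
  · intro z hz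
    rw [Set.uIcc_of_le zero_le_one] at hz
    exact hmean_algebraMap r ht hz

end positivity

lemma Represents.horAvg_eq {F : LayerFunctions Lx Ly} {f : ScalarField} (h : Represents F f)
    {t z : ℝ} (ht : 0 < t) (hz : z ∈ Set.Icc (0 : ℝ) 1) : horAvg Lx Ly f t z = hmean F t z := by
  have : ∀ x y, f t x y z = zeroExt F (t, x, y, z) := fun x y => h t x y z ⟨ht, hz⟩
  simp only [hmean, horAvg, this]

lemma Represents.volAvg_eq {F : LayerFunctions Lx Ly} {f : ScalarField} (h : Represents F f)
    {t : ℝ} (ht : 0 < t) : volAvg Lx Ly f t = avg t F := by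
  rw [avg_apply, volAvg]
  refine intervalIntegral.integral_congr fun z hz => ?_
  rw [Set.uIcc_of_le zero_le_one] at hz
  exact h.horAvg_eq ht hz

/-! ### Calculus in the algebra: plates, constants, functions of height -/

/-- Evaluation of layer functions at a point of the layer. -/
def ev (q : layer) : LayerFunctions Lx Ly →ₐ[ℝ] ℝ :=
  (Pi.evalAlgHom ℝ (fun _ : layer => ℝ) q).comp (LayerFunctions Lx Ly).val

lemma zeroExt_eq_ev (F : LayerFunctions Lx Ly) {q : SpaceTime} (hq : q ∈ layer) :
    zeroExt F q = ev ⟨q, hq⟩ F := zeroExt_of_mem _ hq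

/-- The height of a point of the layer. -/
def height (q : layer) : ℝ := q.1.2.2.2

lemma height_nonneg (q : layer) : 0 ≤ height q := q.2.2.1

lemma height_le_one (q : layer) : height q ≤ 1 := q.2.2.2

/-- The layer functions that vanish on both plates. -/
def platesIdeal (Lx Ly : ℝ) : Ideal (LayerFunctions Lx Ly) where
  carrier := {F | ∀ q : layer, height q = 0 ∨ height q = 1 → ev q F = 0}
  add_mem' hF hG q hq := by rw [map_add, hF q hq, hG q hq, add_zero]
  zero_mem' q _ := map_zero _
  smul_mem' c F hF q hq := by rw [smul_eq_mul, map_mul, hF q hq, mul_zero]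

lemma mem_platesIdeal {F : LayerFunctions Lx Ly} :
    F ∈ platesIdeal Lx Ly ↔ ∀ q : layer, height q = 0 ∨ height q = 1 → ev q F = 0 := Iff.rfl

lemma Dx_mem_platesIdeal {F : LayerFunctions Lx Ly} (hF : F ∈ platesIdeal Lx Ly) :
    Dx F ∈ platesIdeal Lx Ly := by
  rintro ⟨⟨t, x, y, z⟩, hq⟩ hz
  rw [← zeroExt_eq_ev _ hq, ← (hasDerivAt_x F hq).deriv]
  have : (fun s => zeroExt F (t, s, y, z)) = fun _ => 0 := funext fun s => by
    rw [zeroExt_eq_ev F (q := (t, s, y, z)) hq]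
    exact hF _ hz
  rw [this, deriv_const]

lemma Dy_mem_platesIdeal {F : LayerFunctions Lx Ly} (hF : F ∈ platesIdeal Lx Ly) :
    Dy F ∈ platesIdeal Lx Ly := by
  rintro ⟨⟨t, x, y, z⟩, hq⟩ hz
  rw [← zeroExt_eq_ev _ hq, ← (hasDerivAt_y F hq).deriv]
  have : (fun s => zeroExt F (t, x, s, z)) = fun _ => 0 := funext fun s => by
    rw [zeroExt_eq_ev F (q := (t, x, s, z)) hq]
    exact hF _ hz
  rw [this, deriv_const]

lemma avg_Dz_of_mem {F : LayerFunctions Lx Ly} (hF : F ∈ platesIdeal Lx Ly) (t : ℝ) :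
    avg t (Dz F) = 0 := by
  rcases le_or_gt t 0 with ht | ht
  · exact avg_of_nonpos _ ht
  have h : ∀ z, z = 0 ∨ z = 1 → hmean F t z = 0 := by
    intro z hz
    have hz' : z ∈ Set.Icc (0 : ℝ) 1 := by rcases hz with rfl | rfl <;> simp
    have : ∀ x y, zeroExt F (t, x, y, z) = 0 := fun x y => by
      rw [zeroExt_eq_ev F (q := (t, x, y, z)) ⟨ht, hz'⟩]
      exact hF _ hz
    simp [hmean, horAvg, this]
  rw [avg_Dz, h 1 (Or.inr rfl), h 0 (Or.inl rfl), sub_zero]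

/-- The divergence theorem for fields without flux through the plates. -/
lemma avg_eq_zero_of_divergence {X P Q S : LayerFunctions Lx Ly} (hS : S ∈ platesIdeal Lx Ly)
    (h : X = Dx P + Dy Q + Dz S) (t : ℝ) : avg t X = 0 := by
  rw [h, map_add, map_add, avg_Dx, avg_Dy, avg_Dz_of_mem hS, add_zero, add_zero]

/-- The constant layer function `r`. -/
abbrev cst (r : ℝ) : LayerFunctions Lx Ly := algebraMap ℝ (LayerFunctions Lx Ly) r

lemma ev_cst (q : layer) (r : ℝ) : ev q (cst r : LayerFunctions Lx Ly) = r :=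
  (ev q : LayerFunctions Lx Ly →ₐ[ℝ] ℝ).commutes r

lemma partialD_cst (v : SpaceTime) (r : ℝ) : partialD v (cst r : LayerFunctions Lx Ly) = 0 :=
  Derivation.map_algebraMap _ _

lemma avg_cst_mul (t r : ℝ) (F : LayerFunctions Lx Ly) : avg t (cst r * F) = r * avg t F := by
  rw [← Algebra.smul_def, map_smul, smul_eq_mul]

lemma avg_ofNat_mul (t : ℝ) (n : ℕ) [n.AtLeastTwo] (F : LayerFunctions Lx Ly) :
    avg t (ofNat(n) * F) = ofNat(n) * avg t F := by
  have : (ofNat(n) : LayerFunctions Lx Ly) = cst (ofNat(n) : ℝ) := by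
    rw [cst, map_ofNat]
  rw [this, avg_cst_mul]

lemma Dz_Dx (F : LayerFunctions Lx Ly) : Dz (Dx F) = Dx (Dz F) := partialD_comm _ _ _
lemma Dz_Dy (F : LayerFunctions Lx Ly) : Dz (Dy F) = Dy (Dz F) := partialD_comm _ _ _
lemma Dy_Dx (F : LayerFunctions Lx Ly) : Dy (Dx F) = Dx (Dy F) := partialD_comm _ _ _

lemma partialD_pow_two (v : SpaceTime) (F : LayerFunctions Lx Ly) :
    partialD v (F ^ 2) = 2 * F * partialD v F := by
  rw [pow_two, Derivation.leibniz, smul_eq_mul]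
  ring

lemma partialD_mul (v : SpaceTime) (F G : LayerFunctions Lx Ly) :
    partialD v (F * G) = F * partialD v G + G * partialD v F := by
  rw [Derivation.leibniz, smul_eq_mul, smul_eq_mul]

lemma partialD_ofNat (v : SpaceTime) (n : ℕ) [n.AtLeastTwo] :
    partialD v (ofNat(n) : LayerFunctions Lx Ly) = 0 :=
  (partialD v).map_natCast n

/-- The vertical coordinate `z` as a layer function. -/
def zc : LayerFunctions Lx Ly :=
  ⟨height, (contDiff_snd.snd.snd.contDiffOn).congr fun q hq => zeroExt_of_mem height hq,
    fun q => by
      by_cases hq : q ∈ layer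
      · rw [zeroExt_of_mem _ hq, zeroExt_of_mem _ (add_horizontal_mem_layer.2 hq)]
        simp [height]
      · rw [zeroExt_of_notMem _ hq, zeroExt_of_notMem _ (mt add_horizontal_mem_layer.1 hq)],
    fun q => by
      by_cases hq : q ∈ layer
      · rw [zeroExt_of_mem _ hq, zeroExt_of_mem _ (add_horizontal_mem_layer.2 hq)]
        simp [height]
      · rw [zeroExt_of_notMem _ hq, zeroExt_of_notMem _ (mt add_horizontal_mem_layer.1 hq)]⟩

lemma ev_zc (q : layer) : ev q (zc : LayerFunctions Lx Ly) = height q := rfl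

lemma partialD_zc (v : SpaceTime) :
    partialD v (zc : LayerFunctions Lx Ly) = cst v.2.2.2 := by
  ext q
  have h : ∀ r ∈ layer, zeroExt (zc : LayerFunctions Lx Ly) r = r.2.2.2 :=
    fun r hr => zeroExt_of_mem _ hr
  rw [partialD_apply, fderivWithin_congr h (h _ q.2)]
  have : HasFDerivAt (fun r : SpaceTime => r.2.2.2)
      ((ContinuousLinearMap.snd ℝ ℝ ℝ).comp ((ContinuousLinearMap.snd ℝ ℝ (ℝ × ℝ)).comp
        (ContinuousLinearMap.snd ℝ ℝ (ℝ × ℝ × ℝ)))) q.1 :=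
    hasFDerivAt_snd.comp q.1 (hasFDerivAt_snd.comp q.1 hasFDerivAt_snd)
  rw [(this.hasFDerivWithinAt).fderivWithin (uniqueDiffOn_layer _ q.2)]
  rfl

lemma Dz_zc : Dz (zc : LayerFunctions Lx Ly) = 1 := by rw [partialD_zc]; exact map_one _
lemma Dx_zc : Dx (zc : LayerFunctions Lx Ly) = 0 := by rw [partialD_zc]; exact map_zero _
lemma Dy_zc : Dy (zc : LayerFunctions Lx Ly) = 0 := by rw [partialD_zc]; exact map_zero _
lemma Dt_zc : Dt (zc : LayerFunctions Lx Ly) = 0 := by rw [partialD_zc]; exact map_zero _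

/-- The layer function `1 / (z + δ)`, whose powers serve as weights concentrated in a layer of
width `δ` at the bottom plate. -/
def bw (δ : ℝ) (hδ : 0 < δ) : LayerFunctions Lx Ly :=
  ⟨fun q => (height q + δ)⁻¹, by
    have h : ContDiffOn ℝ ∞ (fun q : SpaceTime => (q.2.2.2 + δ)⁻¹) layer :=
      ContDiffOn.inv (contDiff_snd.snd.snd.add contDiff_const).contDiffOn
        fun q hq => (add_pos_of_nonneg_of_pos hq.2.1 hδ).ne'
    exact h.congr fun q hq => zeroExt_of_mem _ hq,
    fun q => by
      by_cases hq : q ∈ layer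
      · rw [zeroExt_of_mem _ hq, zeroExt_of_mem _ (add_horizontal_mem_layer.2 hq)]
        simp [height]
      · rw [zeroExt_of_notMem _ hq, zeroExt_of_notMem _ (mt add_horizontal_mem_layer.1 hq)],
    fun q => by
      by_cases hq : q ∈ layer
      · rw [zeroExt_of_mem _ hq, zeroExt_of_mem _ (add_horizontal_mem_layer.2 hq)]
        simp [height]
      · rw [zeroExt_of_notMem _ hq, zeroExt_of_notMem _ (mt add_horizontal_mem_layer.1 hq)]⟩

section weights

variable {δ : ℝ} {hδ : 0 < δ}

lemma ev_bw (q : layer) : ev q (bw δ hδ : LayerFunctions Lx Ly) = (height q + δ)⁻¹ := rfl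

lemma ev_bw_pos (q : layer) : 0 < ev q (bw δ hδ : LayerFunctions Lx Ly) := by
  rw [ev_bw]
  exact inv_pos.2 (add_pos_of_nonneg_of_pos (height_nonneg q) hδ)

lemma bw_mul : (bw δ hδ : LayerFunctions Lx Ly) * (zc + cst δ) = 1 := by
  ext q
  exact inv_mul_cancel₀ (add_pos_of_nonneg_of_pos (height_nonneg q) hδ).ne'

lemma partialD_bw (v : SpaceTime) :
    partialD v (bw δ hδ : LayerFunctions Lx Ly) = - (cst v.2.2.2 * bw δ hδ ^ 2) := by
  have h := congrArg (partialD v) (bw_mul (Lx := Lx) (Ly := Ly) (hδ := hδ))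
  rw [partialD_mul, map_add, Derivation.map_algebraMap, Derivation.map_one_eq_zero, add_zero,
    partialD_zc] at h
  linear_combination bw δ hδ * h - partialD v (bw δ hδ) * bw_mul (hδ := hδ)

lemma Dz_bw : Dz (bw δ hδ : LayerFunctions Lx Ly) = - bw δ hδ ^ 2 := by
  rw [partialD_bw]; simp
lemma Dx_bw : Dx (bw δ hδ : LayerFunctions Lx Ly) = 0 := by rw [partialD_bw]; simp
lemma Dy_bw : Dy (bw δ hδ : LayerFunctions Lx Ly) = 0 := by rw [partialD_bw]; simp

section positivity
variable [Fact (0 < Lx)] [Fact (0 < Ly)]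

lemma avg_nonneg_of_ev {F : LayerFunctions Lx Ly} (h : ∀ q, 0 ≤ ev q F) (t : ℝ) : 0 ≤ avg t F :=
  avg_nonneg fun q _ => h q

lemma avg_mono_of_ev {F G : LayerFunctions Lx Ly} (h : ∀ q, ev q F ≤ ev q G) (t : ℝ) :
    avg t F ≤ avg t G :=
  avg_mono fun q _ => h q

/-! ### Hardy and Poincaré inequalities -/

/-- A Hardy inequality: expand the square of
`2 (z + δ)^{-1} ∂z f - 3 (z + δ)^{-2} f` and integrate the cross term by parts. -/
lemma hardy_bw_two {f : LayerFunctions Lx Ly} (hf : f ∈ platesIdeal Lx Ly) (t : ℝ) :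
    9 * avg t (bw δ hδ ^ 4 * f ^ 2) ≤ 4 * avg t (bw δ hδ ^ 2 * Dz f ^ 2) := by
  have h := avg_sq_nonneg t (2 * (bw δ hδ * Dz f) - 3 * (bw δ hδ ^ 2 * f))
  have h0 : avg t (4 * (bw δ hδ ^ 2 * Dz f ^ 2) - 9 * (bw δ hδ ^ 4 * f ^ 2) -
      (2 * (bw δ hδ * Dz f) - 3 * (bw δ hδ ^ 2 * f)) ^ 2) = 0 := by
    refine avg_eq_zero_of_divergence (P := 0) (Q := 0) (S := 6 * (bw δ hδ ^ 3 * f ^ 2))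
      (Ideal.mul_mem_left _ _ (Ideal.mul_mem_left _ _ (Ideal.pow_mem_of_mem _ hf 2 two_pos))) ?_ t
    simp only [map_zero, partialD_mul, pow_succ, pow_zero, one_mul,
      partialD_ofNat, Dz_bw]
    ring
  simp only [map_sub, avg_ofNat_mul] at h0
  linarith

lemma hardy_bw_four {f : LayerFunctions Lx Ly} (hf : f ∈ platesIdeal Lx Ly) (t : ℝ) :
    25 * avg t (bw δ hδ ^ 6 * f ^ 2) ≤ 4 * avg t (bw δ hδ ^ 4 * Dz f ^ 2) := by
  have h := avg_sq_nonneg t (2 * (bw δ hδ ^ 2 * Dz f) - 5 * (bw δ hδ ^ 3 * f))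
  have h0 : avg t (4 * (bw δ hδ ^ 4 * Dz f ^ 2) - 25 * (bw δ hδ ^ 6 * f ^ 2) -
      (2 * (bw δ hδ ^ 2 * Dz f) - 5 * (bw δ hδ ^ 3 * f)) ^ 2) = 0 := by
    refine avg_eq_zero_of_divergence (P := 0) (Q := 0) (S := 10 * (bw δ hδ ^ 5 * f ^ 2))
      (Ideal.mul_mem_left _ _ (Ideal.mul_mem_left _ _ (Ideal.pow_mem_of_mem _ hf 2 two_pos))) ?_ t
    simp only [map_zero, partialD_mul, pow_succ, pow_zero, one_mul, partialD_ofNat, Dz_bw]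
    ring
  simp only [map_sub, avg_ofNat_mul] at h0
  linarith

lemma hardy_bw_zero {f : LayerFunctions Lx Ly} (hf : f ∈ platesIdeal Lx Ly) (t : ℝ) :
    avg t (bw δ hδ ^ 2 * f ^ 2) ≤ 4 * avg t (Dz f ^ 2) := by
  have h := avg_sq_nonneg t (2 * Dz f - bw δ hδ * f)
  have h0 : avg t (4 * Dz f ^ 2 - bw δ hδ ^ 2 * f ^ 2 - (2 * Dz f - bw δ hδ * f) ^ 2) = 0 := by
    refine avg_eq_zero_of_divergence (P := 0) (Q := 0) (S := 2 * (bw δ hδ * f ^ 2))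
      (Ideal.mul_mem_left _ _ (Ideal.mul_mem_left _ _ (Ideal.pow_mem_of_mem _ hf 2 two_pos))) ?_ t
    simp only [map_zero, partialD_mul, pow_succ, pow_zero, one_mul, partialD_ofNat, Dz_bw]
    ring
  simp only [map_sub, avg_ofNat_mul] at h0
  linarith

/-- A Poincaré inequality, by completing the square with the weight `1 - 2 z`. -/
lemma poincare {f : LayerFunctions Lx Ly} (hf : f ∈ platesIdeal Lx Ly) (t : ℝ) :
    avg t (f ^ 2) ≤ avg t (Dz f ^ 2) := by
  have h := avg_sq_nonneg t (Dz f - (1 - 2 * zc) * f)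
  have h1 : 0 ≤ avg t (4 * (zc * (1 - zc) * f ^ 2)) := avg_nonneg_of_ev (fun q => by
    simp only [map_mul, map_sub, map_pow, map_one, map_ofNat, ev_zc]
    have := height_nonneg q
    have := sub_nonneg.2 (height_le_one q)
    positivity) t
  have h0 : avg t (Dz f ^ 2 - f ^ 2 - 4 * (zc * (1 - zc) * f ^ 2) -
      (Dz f - (1 - 2 * zc) * f) ^ 2) = 0 := by
    refine avg_eq_zero_of_divergence (P := 0) (Q := 0) (S := (1 - 2 * zc) * f ^ 2)
      (Ideal.mul_mem_left _ _ (Ideal.pow_mem_of_mem _ hf 2 two_pos)) ?_ t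
    simp only [map_zero, map_sub, partialD_mul, pow_succ, pow_zero, one_mul, partialD_ofNat,
      Dz_zc, Derivation.map_one_eq_zero]
    ring
  simp only [map_sub] at h0
  linarith

end positivity

end weights

section biharmonic

variable {δ : ℝ} {hδ : 0 < δ}

/-! ### The vertical velocity as a solution of a biharmonic problem -/

/-- `w` solves `Δ²w = -R (∂x² + ∂y²) T` with `w = ∂z w = 0` on the plates. -/
structure IsBiharmonic (R : ℝ) (w T : LayerFunctions Lx Ly) : Prop where
  mem : w ∈ platesIdeal Lx Ly
  Dz_mem : Dz w ∈ platesIdeal Lx Ly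
  eq : Dx (Dx (Dx (Dx w))) + Dy (Dy (Dy (Dy w))) + Dz (Dz (Dz (Dz w)))
    + 2 * Dx (Dx (Dy (Dy w))) + 2 * Dx (Dx (Dz (Dz w))) + 2 * Dy (Dy (Dz (Dz w)))
    + cst R * (Dx (Dx T) + Dy (Dy T)) = 0

namespace IsBiharmonic

variable {R : ℝ} {w T : LayerFunctions Lx Ly}

lemma isBiharmonic_Dx (h : IsBiharmonic R w T) : IsBiharmonic R (Dx w) (Dx T) where
  mem := Dx_mem_platesIdeal h.mem
  Dz_mem := by rw [Dz_Dx]; exact Dx_mem_platesIdeal h.Dz_mem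
  eq := by
    have := congrArg Dx h.eq
    simp only [map_add, map_zero, partialD_mul, partialD_cst, partialD_ofNat] at this
    simp only [Dz_Dx, Dy_Dx] at this ⊢
    linear_combination this

lemma isBiharmonic_Dy (h : IsBiharmonic R w T) : IsBiharmonic R (Dy w) (Dy T) where
  mem := Dy_mem_platesIdeal h.mem
  Dz_mem := by rw [Dz_Dy]; exact Dy_mem_platesIdeal h.Dz_mem
  eq := by
    have := congrArg Dy h.eq
    simp only [map_add, map_zero, partialD_mul, partialD_cst, partialD_ofNat] at this
    simp only [Dz_Dy, Dy_Dx] at this ⊢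
    linear_combination this

lemma energy_identity (h : IsBiharmonic R w T) (t : ℝ) :
    avg t (Dz (Dz w) ^ 2) + 2 * avg t (Dx (Dz w) ^ 2) + 2 * avg t (Dy (Dz w) ^ 2)
      + avg t ((Dx (Dx w) + Dy (Dy w)) ^ 2) + R * avg t ((Dx (Dx w) + Dy (Dy w)) * T) = 0 := by
  have h0 : avg t (Dz (Dz w) ^ 2 + 2 * Dx (Dz w) ^ 2 + 2 * Dy (Dz w) ^ 2
      + (Dx (Dx w) + Dy (Dy w)) ^ 2 + cst R * ((Dx (Dx w) + Dy (Dy w)) * T)) = 0 := by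
    refine avg_eq_zero_of_divergence
      (P := -(2 * (w * Dx (Dz (Dz w))) + w * Dx (Dx (Dx w)) - Dx w * Dx (Dx w)
        + 2 * (w * Dx (Dy (Dy w))) - 2 * (Dx w * Dy (Dy w))
        + cst R * (w * Dx T - Dx w * T)))
      (Q := -(2 * (w * Dy (Dz (Dz w))) + w * Dy (Dy (Dy w)) - Dy w * Dy (Dy w)
        + cst R * (w * Dy T - Dy w * T)))
      (S := -(w * Dz (Dz (Dz w)) - Dz w * Dz (Dz w)
        - 2 * (Dx w * Dx (Dz w)) - 2 * (Dy w * Dy (Dz w)))) ?_ ?_ t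
    · refine neg_mem (sub_mem (sub_mem (sub_mem ?_ ?_) ?_) ?_)
      · exact Ideal.mul_mem_right _ _ h.mem
      · exact Ideal.mul_mem_right _ _ h.Dz_mem
      · exact Ideal.mul_mem_left _ _ (Ideal.mul_mem_right _ _ (Dx_mem_platesIdeal h.mem))
      · exact Ideal.mul_mem_left _ _ (Ideal.mul_mem_right _ _ (Dy_mem_platesIdeal h.mem))
    · have := h.eq
      simp only [map_neg, map_add, map_sub, partialD_mul, partialD_ofNat,
        partialD_cst]
      simp only [Dz_Dx, Dz_Dy] at this ⊢
      linear_combination w * this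
  simpa only [map_add, avg_ofNat_mul, avg_cst_mul] using h0

/-- The horizontal Laplacian controls all second horizontal derivatives. -/
lemma avg_sq_horizontal_laplacian (w : LayerFunctions Lx Ly) (t : ℝ) :
    avg t ((Dx (Dx w) + Dy (Dy w)) ^ 2) =
      avg t (Dx (Dx w) ^ 2) + 2 * avg t (Dx (Dy w) ^ 2) + avg t (Dy (Dy w) ^ 2) := by
  have h0 : avg t ((Dx (Dx w) + Dy (Dy w)) ^ 2 - Dx (Dx w) ^ 2 - 2 * Dx (Dy w) ^ 2
      - Dy (Dy w) ^ 2) = 0 := by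
    refine avg_eq_zero_of_divergence (P := -(2 * (Dx (Dy w) * Dy w)))
      (Q := 2 * (Dx (Dx w) * Dy w)) (S := 0) (zero_mem _) ?_ t
    simp only [map_neg, map_zero, partialD_mul, partialD_ofNat, Dy_Dx]
    ring
  simp only [map_sub, avg_ofNat_mul] at h0
  linarith

/-- The Pohozaev identity: the biharmonic equation tested with `h ∂z w`, where `h` depends only
on the height and vanishes on the plates. -/
lemma pohozaev (hw : IsBiharmonic R w T) {h : LayerFunctions Lx Ly} (hx : Dx h = 0)
    (hy : Dy h = 0) (hh : h ∈ platesIdeal Lx Ly) (t : ℝ) :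
    avg t (3 * (Dz h * Dz (Dz w) ^ 2) - Dz (Dz (Dz h)) * Dz w ^ 2
      + 2 * (Dz h * (Dx (Dz w) ^ 2 + Dy (Dz w) ^ 2))
      + 2 * (h * (Dx (Dx (Dz w)) * Dx (Dx w) + 2 * (Dx (Dy (Dz w)) * Dx (Dy w))
        + Dy (Dy (Dz w)) * Dy (Dy w)))
      - 2 * (cst R * (h * (Dx (Dz w) * Dx T + Dy (Dz w) * Dy T)))) = 0 := by
  refine avg_eq_zero_of_divergence
    (P := -(4 * (h * Dz w * Dx (Dz (Dz w))) + 2 * (h * Dz w * Dx (Dx (Dx w)))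
      - 2 * (h * Dx (Dz w) * Dx (Dx w)) + 4 * (h * Dz w * Dx (Dy (Dy w)))
      + 2 * (cst R * (h * Dz w * Dx T))))
    (Q := -(4 * (h * Dz w * Dy (Dz (Dz w))) + 2 * (h * Dz w * Dy (Dy (Dy w)))
      - 2 * (h * Dy (Dz w) * Dy (Dy w)) - 4 * (h * Dx (Dz w) * Dx (Dy w))
      + 2 * (cst R * (h * Dz w * Dy T))))
    (S := -(2 * (h * (Dz w * Dz (Dz (Dz w)))) - 2 * (Dz h * Dz (Dz w) * Dz w)
      - h * Dz (Dz w) ^ 2 + Dz (Dz h) * Dz w * Dz w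
      - 2 * (h * (Dx (Dz w) ^ 2 + Dy (Dz w) ^ 2)))) ?_ ?_ t
  · refine neg_mem (sub_mem (add_mem (sub_mem (sub_mem ?_ ?_) ?_) ?_) ?_)
    · exact Ideal.mul_mem_left _ _ (Ideal.mul_mem_right _ _ hh)
    · exact Ideal.mul_mem_left _ _ (Ideal.mul_mem_left _ _ hw.Dz_mem)
    · exact Ideal.mul_mem_right _ _ hh
    · exact Ideal.mul_mem_left _ _ hw.Dz_mem
    · exact Ideal.mul_mem_left _ _ (Ideal.mul_mem_right _ _ hh)
  · have := hw.eq
    simp only [map_neg, map_add, map_sub, partialD_mul, partialD_ofNat, partialD_pow_two,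
      partialD_cst, hx, hy]
    simp only [Dz_Dx, Dz_Dy, Dy_Dx] at this ⊢
    linear_combination 2 * h * Dz w * this

section positivity
variable [Fact (0 < Lx)] [Fact (0 < Ly)]

/-- The energy estimate. The right-hand side of the energy identity is split by Young's inequality
so that half of the horizontal second derivatives is absorbed. -/
lemma energy_bound (h : IsBiharmonic R w T) (t : ℝ) :
    2 * avg t (Dz (Dz w) ^ 2) + 4 * (avg t (Dx (Dz w) ^ 2) + avg t (Dy (Dz w) ^ 2))
      + (avg t (Dx (Dx w) ^ 2) + 2 * avg t (Dx (Dy w) ^ 2) + avg t (Dy (Dy w) ^ 2))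
      ≤ R ^ 2 * avg t (T ^ 2) := by
  have h1 := h.energy_identity t
  have h2 := avg_sq_horizontal_laplacian w t
  have h3 := avg_sq_nonneg t (Dx (Dx w) + Dy (Dy w) + cst R * T)
  have h4 : (Dx (Dx w) + Dy (Dy w) + cst R * T) ^ 2 = (Dx (Dx w) + Dy (Dy w)) ^ 2
      + 2 * (cst R * ((Dx (Dx w) + Dy (Dy w)) * T)) + cst (R ^ 2) * T ^ 2 := by
    rw [cst, cst, map_pow]
    ring
  rw [h4] at h3
  simp only [map_add, avg_ofNat_mul, avg_cst_mul] at h3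
  linarith

/-- The vertical velocity is small near the bottom plate, uniformly in the horizontal scale. In the
Pohozaev identity the weighted integrals of `(∂z² w)²` and `(∂z w)²` have opposite signs, but by
Hardy's inequality their sum still dominates the weighted integral of `w²`; all other terms are
controlled by the energy bound for `w`, `∂x w` and `∂y w`. -/
lemma weighted_bound (hw : IsBiharmonic R w T) (hT : T ∈ platesIdeal Lx Ly) (t : ℝ) :
    25 * (δ * avg t (bw δ hδ ^ 6 * w ^ 2)) ≤
      8 * R ^ 2 * (avg t (Dx T ^ 2) + avg t (Dy T ^ 2) + avg t (Dz T ^ 2)) := by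
  set m : LayerFunctions Lx Ly := bw δ hδ with hm
  set s : ℝ := (1 + δ)⁻¹ with hs
  have hδ1 : 0 < 1 + δ := by linarith
  have hs0 : 0 < s := inv_pos.2 hδ1
  have hs1 : s ≤ 1 := inv_le_one_of_one_le₀ (by linarith)
  -- The multiplier `h = z / (z + δ) - z / (1 + δ)` is bounded while `h'` is of size `1 / δ` near
  -- the bottom plate, which puts a large weight on `∂z² w` there.
  set h : LayerFunctions Lx Ly := 1 - cst δ * m - cst s * zc with hh
  have ev_h : ∀ q, ev q h = 1 - δ * (height q + δ)⁻¹ - s * height q := fun q => by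
    simp only [hh, map_sub, map_mul, map_one, ev_cst, ev_zc, hm, ev_bw]
  have ev_h' : ∀ q, ev q h = s * (height q + δ)⁻¹ * height q * (1 - height q) := fun q => by
    have : 0 < height q + δ := add_pos_of_nonneg_of_pos (height_nonneg q) hδ
    rw [ev_h, hs]
    field_simp
    ring
  have hz : h ∈ platesIdeal Lx Ly := fun q hq => by
    rw [ev_h']
    rcases hq with hq | hq <;> simp [hq]
  have hDx : Dx h = 0 := by
    simp only [hh, map_sub, partialD_mul, partialD_cst, hm, Dx_bw, Dx_zc,
      Derivation.map_one_eq_zero, mul_zero, add_zero, sub_zero]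
  have hDy : Dy h = 0 := by
    simp only [hh, map_sub, partialD_mul, partialD_cst, hm, Dy_bw, Dy_zc,
      Derivation.map_one_eq_zero, mul_zero, add_zero, sub_zero]
  have hDz : Dz h = cst δ * m ^ 2 - cst s := by
    simp only [hh, map_sub, partialD_mul, partialD_cst, hm, Dz_bw, Dz_zc,
      Derivation.map_one_eq_zero]
    ring
  have hDzzz : Dz (Dz (Dz h)) = 6 * (cst δ * m ^ 4) := by
    rw [hDz]
    simp only [map_sub, map_add, map_neg, map_zero, partialD_mul, partialD_cst, hm, Dz_bw,
      pow_succ, pow_zero, one_mul]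
    ring
  have h1 := hw.pohozaev hDx hDy hz t
  rw [hDzzz, hDz] at h1
  -- Everything except the weighted integrals near the bottom plate is bounded pointwise.
  have h2 : avg t (3 * (cst δ * (m ^ 2 * Dz (Dz w) ^ 2)) - 6 * (cst δ * (m ^ 4 * Dz w ^ 2))) ≤
      avg t (3 * ((cst δ * m ^ 2 - cst s) * Dz (Dz w) ^ 2) - 6 * (cst δ * m ^ 4) * Dz w ^ 2
      + 2 * ((cst δ * m ^ 2 - cst s) * (Dx (Dz w) ^ 2 + Dy (Dz w) ^ 2))
      + 2 * (h * (Dx (Dx (Dz w)) * Dx (Dx w) + 2 * (Dx (Dy (Dz w)) * Dx (Dy w))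
        + Dy (Dy (Dz w)) * Dy (Dy w)))
      - 2 * (cst R * (h * (Dx (Dz w) * Dx T + Dy (Dz w) * Dy T)))
      + (3 * Dz (Dz w) ^ 2 + 4 * Dx (Dz w) ^ 2 + 4 * Dy (Dz w) ^ 2
      + 2 * Dx (Dx (Dz w)) ^ 2 + 4 * Dx (Dy (Dz w)) ^ 2 + 2 * Dy (Dy (Dz w)) ^ 2
      + cst (1 / 2) * (Dx (Dx w) ^ 2 + 2 * Dx (Dy w) ^ 2 + Dy (Dy w) ^ 2)
      + cst (R ^ 2 / 2) * (Dx T ^ 2 + Dy T ^ 2))) := by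
    refine avg_mono_of_ev (fun q => ?_) t
    have hq0 : 0 ≤ ev q h := by
      rw [ev_h']
      have := height_nonneg q
      have := sub_nonneg.2 (height_le_one q)
      positivity
    have hq1 : ev q h ≤ 1 := by
      rw [ev_h]
      have := height_nonneg q
      have : 0 ≤ δ * (height q + δ)⁻¹ := by positivity
      have : 0 ≤ s * height q := by positivity
      linarith
    have young : ∀ a b : ℝ, 0 ≤ 2 * (ev q h * (a * b)) + 2 * a ^ 2 + 1 / 2 * b ^ 2 := by
      intro a b
      have : ev q h ^ 2 ≤ 1 := by nlinarith
      nlinarith [sq_nonneg (2 * a + ev q h * b),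
        mul_nonneg (sub_nonneg.2 this) (sq_nonneg b)]
    simp only [map_add, map_sub, map_mul, map_pow, map_ofNat, ev_cst]
    generalize ev q m = M
    have y1 := young (ev q (Dx (Dx (Dz w)))) (ev q (Dx (Dx w)))
    have y2 := young (ev q (Dx (Dy (Dz w)))) (ev q (Dx (Dy w)))
    have y3 := young (ev q (Dy (Dy (Dz w)))) (ev q (Dy (Dy w)))
    have y4 := young (ev q (Dx (Dz w))) (-(R * ev q (Dx T)))
    have y5 := young (ev q (Dy (Dz w))) (-(R * ev q (Dy T)))
    have p1 : 0 ≤ δ * M ^ 2 * (ev q (Dx (Dz w)) ^ 2 + ev q (Dy (Dz w)) ^ 2) := by positivity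
    have p2 : 0 ≤ (1 - s) * (3 * ev q (Dz (Dz w)) ^ 2 + 2 * (ev q (Dx (Dz w)) ^ 2
        + ev q (Dy (Dz w)) ^ 2)) :=
      mul_nonneg (sub_nonneg.2 hs1) (by positivity)
    linarith
  rw [map_add (avg t) (_ - _), h1] at h2
  simp only [map_add, map_sub, avg_ofNat_mul, avg_cst_mul, zero_add] at h2
  -- Horizontal derivatives solve the same problem, so the energy bound applies to them too.
  have e := hw.energy_bound t
  have ex := hw.isBiharmonic_Dx.energy_bound t
  have ey := hw.isBiharmonic_Dy.energy_bound t
  simp only [Dz_Dx, Dz_Dy, Dy_Dx] at ex ey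
  have n1 := avg_sq_nonneg t (Dz (Dz (Dx w)))
  have n2 := avg_sq_nonneg t (Dz (Dz (Dy w)))
  have n3 := avg_sq_nonneg t (Dx (Dx (Dx w)))
  have n4 := avg_sq_nonneg t (Dx (Dx (Dy w)))
  have n5 := avg_sq_nonneg t (Dx (Dy (Dy w)))
  have n6 := avg_sq_nonneg t (Dy (Dy (Dy w)))
  have n7 := avg_sq_nonneg t (Dx (Dz w))
  have n8 := avg_sq_nonneg t (Dy (Dz w))
  have n9 := avg_sq_nonneg t (Dx (Dx w))
  have n10 := avg_sq_nonneg t (Dx (Dy w))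
  have n11 := avg_sq_nonneg t (Dy (Dy w))
  simp only [Dz_Dx, Dz_Dy] at n1 n2
  have a1 := mul_le_mul_of_nonneg_left (hardy_bw_two (hδ := hδ) hw.Dz_mem t) hδ.le
  have a2 := mul_le_mul_of_nonneg_left (hardy_bw_four (hδ := hδ) hw.mem t) hδ.le
  have px := mul_nonneg (sq_nonneg R) (avg_sq_nonneg t (Dx T))
  have py := mul_nonneg (sq_nonneg R) (avg_sq_nonneg t (Dy T))
  have po := mul_le_mul_of_nonneg_left (poincare hT t) (sq_nonneg R)
  rw [← hm] at a1 a2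
  linarith

/-- The convective transport near the bottom plate is controlled by the dissipation: Young's
inequality between `(z + δ)^{-3} w`, bounded by `weighted_bound`, and `(z + δ)^{-1} T`, bounded by
Hardy's inequality. -/
lemma transport_bound (hw : IsBiharmonic R w T) (hT : T ∈ platesIdeal Lx Ly) (hR : 0 < R)
    {ε : ℝ} (hε2 : ε ^ 2 = δ) (t : ℝ) :
    50 * (ε * avg t (bw δ hδ ^ 4 * (w * T))) ≤
      57 * R * (avg t (Dx T ^ 2) + avg t (Dy T ^ 2) + avg t (Dz T ^ 2)) := by
  have h1 := hw.weighted_bound (hδ := hδ) hT t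
  have h2 := hardy_bw_zero (hδ := hδ) hT t
  have n1 := avg_sq_nonneg t (Dx T)
  have n2 := avg_sq_nonneg t (Dy T)
  set N := avg t (Dx T ^ 2) + avg t (Dy T ^ 2) + avg t (Dz T ^ 2) with hN
  -- The ratio `4 ε / R` nearly balances the two bounds and keeps the constants rational.
  have h3 := avg_sq_nonneg t (cst (4 * ε) * (bw δ hδ ^ 3 * w) - cst R * (bw δ hδ * T))
  have h4 : (cst (4 * ε) * (bw δ hδ ^ 3 * w) - cst R * (bw δ hδ * T)) ^ 2 =
      cst (16 * δ) * (bw δ hδ ^ 6 * w ^ 2) - cst (8 * ε * R) * (bw δ hδ ^ 4 * (w * T))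
        + cst (R ^ 2) * (bw δ hδ ^ 2 * T ^ 2) := by
    have c1 : (cst (16 * δ) : LayerFunctions Lx Ly) = cst (4 * ε) ^ 2 := by
      rw [cst, cst, ← map_pow, mul_pow, hε2]
      norm_num
    have c2 : (cst (8 * ε * R) : LayerFunctions Lx Ly) = 2 * cst (4 * ε) * cst R := by
      simp only [cst, map_mul, map_ofNat]
      ring
    rw [c1, c2, cst, cst, cst, map_pow]
    ring
  rw [h4] at h3
  simp only [map_add, map_sub, avg_cst_mul] at h3
  have h5 := mul_le_mul_of_nonneg_left h2 (sq_nonneg R)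
  have h6 : R * (50 * (ε * avg t (bw δ hδ ^ 4 * (w * T)))) ≤ R * (57 * R * N) := by
    nlinarith [mul_nonneg (sq_nonneg R) n1, mul_nonneg (sq_nonneg R) n2]
  exact le_of_mul_le_mul_left h6 hR

end positivity
end IsBiharmonic

end biharmonic

/-! ### The minimum principle -/

lemma second_deriv_nonneg_of_isLocalMin {f f' : ℝ → ℝ} {x c : ℝ} (hmin : IsLocalMin f x)
    (hf : ∀ᶠ y in nhds x, HasDerivAt f (f' y) y) (hf' : HasDerivAt f' c x) : 0 ≤ c := by
  by_contra hc
  have h1 : deriv f =ᶠ[nhds x] f' := hf.mono fun y hy => hy.deriv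
  have h2 : deriv (deriv f) x = c := by rw [h1.deriv_eq, hf'.deriv]
  have hmax : IsLocalMax f x := isLocalMax_of_deriv_deriv_neg (by linarith)
    hmin.deriv_eq_zero hf.self_of_nhds.continuousAt
  have h3 : f =ᶠ[nhds x] fun _ => f x := by
    filter_upwards [hmin, hmax] with y h4 h5 using le_antisymm h5 h4
  have h4 : deriv f =ᶠ[nhds x] fun _ => 0 := by
    filter_upwards [h3.eventually_nhds] with y hy
    rw [Filter.EventuallyEq.deriv_eq hy, deriv_const]
  rw [h4.deriv_eq, deriv_const] at h2
  exact hc h2.le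

lemma deriv_nonpos_of_min_on_left {f : ℝ → ℝ} {a b d : ℝ} (hab : a < b)
    (hf : HasDerivAt f d b) (hmin : ∀ s ∈ Set.Ioo a b, f b ≤ f s) : d ≤ 0 := by
  have h := (hasDerivWithinAt_iff_tendsto_slope' (s := Set.Iio b) (by simp)).1
    hf.hasDerivWithinAt
  refine le_of_tendsto h ?_
  filter_upwards [Ioo_mem_nhdsLT hab] with s hs
  rw [slope_def_field]
  exact div_nonpos_of_nonneg_of_nonpos (sub_nonneg.2 (hmin s hs)) (by linarith [hs.2])

section
variable [hLx : Fact (0 < Lx)] [hLy : Fact (0 < Ly)]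

lemma exists_fundamental_domain (T : LayerFunctions Lx Ly) (t x y z : ℝ) :
    ∃ x' ∈ Set.Icc 0 Lx, ∃ y' ∈ Set.Icc 0 Ly,
      zeroExt T (t, x, y, z) = zeroExt T (t, x', y', z) := by
  have p1 : Function.Periodic (fun x => zeroExt T (t, x, y, z)) Lx := fun s => by
    simpa using T.2.2.1 (t, s, y, z)
  obtain ⟨x', hx', e1⟩ := p1.exists_mem_Ico₀ hLx.out x
  have p2 : Function.Periodic (fun y => zeroExt T (t, x', y, z)) Ly := fun s => by
    simpa using T.2.2.2 (t, x', s, z)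
  obtain ⟨y', hy', e2⟩ := p2.exists_mem_Ico₀ hLy.out y
  exact ⟨x', Set.Ico_subset_Icc_self hx', y', Set.Ico_subset_Icc_self hy', e1.trans e2⟩

/-- The temperature equation with unit heating and cold plates. -/
structure IsHeated (u v w T : LayerFunctions Lx Ly) : Prop where
  mem : T ∈ platesIdeal Lx Ly
  eq : Dt T + (u * Dx T + v * Dy T + w * Dz T) = Dx (Dx T) + Dy (Dy T) + Dz (Dz T) + 1

variable {u v w T : LayerFunctions Lx Ly}

/-- At a negative spatial minimum the heating raises the temperature at rate at least one, so a
lower bound improves at any rate `s < 1` until it reaches zero. -/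
lemma IsHeated.lower_bound (hT : IsHeated u v w T) {a b s M : ℝ} (ha : 0 < a) (hs0 : 0 ≤ s)
    (hs1 : s < 1) (hM : s * (b - a) ≤ M)
    (hinit : ∀ x y z, z ∈ Set.Icc (0 : ℝ) 1 → -M ≤ zeroExt T (a, x, y, z)) {t x y z : ℝ}
    (ht : t ∈ Set.Icc a b) (hz : z ∈ Set.Icc (0 : ℝ) 1) :
    -(M - s * (t - a)) ≤ zeroExt T (t, x, y, z) := by
  let g : SpaceTime → ℝ := fun q => zeroExt T q + (M - s * (q.1 - a))
  let K : Set SpaceTime := Set.Icc a b ×ˢ (Set.Icc 0 Lx ×ˢ (Set.Icc 0 Ly ×ˢ Set.Icc (0 : ℝ) 1))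
  have hK : IsCompact K :=
    isCompact_Icc.prod (isCompact_Icc.prod (isCompact_Icc.prod isCompact_Icc))
  have hKl : K ⊆ layer := fun q hq => ⟨ha.trans_le hq.1.1, hq.2.2.2⟩
  have hg : ContinuousOn g K := by
    refine ((contDiffOn_zeroExt T).continuousOn.mono hKl).add ?_
    fun_prop
  have hne : K.Nonempty := ⟨(t, 0, 0, z), ht, ⟨le_rfl, hLx.out.le⟩, ⟨le_rfl, hLy.out.le⟩, hz⟩
  obtain ⟨⟨t0, x0, y0, z0⟩, hq0, hmin⟩ := hK.exists_isMinOn hne hg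
  -- By periodicity the minimum over one period cell is a minimum over the whole layer, so the
  -- derivative tests apply in the horizontal directions without boundary cases.
  have hmin' : ∀ t x y z, t ∈ Set.Icc a b → z ∈ Set.Icc (0 : ℝ) 1 →
      g (t0, x0, y0, z0) ≤ g (t, x, y, z) := by
    intro t x y z ht hz
    obtain ⟨x', hx', y', hy', e⟩ := exists_fundamental_domain T t x y z
    have : g (t0, x0, y0, z0) ≤ g (t, x', y', z) := hmin ⟨ht, hx', hy', hz⟩
    simpa only [g, e] using this
  suffices h0 : 0 ≤ g (t0, x0, y0, z0) by
    have := h0.trans (hmin' t x y z ht hz)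
    simp only [g] at this
    linarith
  by_contra hneg
  push Not at hneg
  obtain ⟨ht0, -, -, hz0⟩ := hq0
  simp only at ht0 hz0
  have hpos : 0 ≤ M - s * (t0 - a) := by
    have : s * (t0 - a) ≤ s * (b - a) := by
      gcongr
      exact ht0.2
    linarith
  have hl : (t0, x0, y0, z0) ∈ layer := ⟨ha.trans_le ht0.1, hz0⟩
  have hat : a < t0 := by
    refine lt_of_le_of_ne ht0.1 fun h => ?_
    have := hinit x0 y0 z0 hz0
    simp only [g, ← h] at hneg
    simp at hneg
    linarith
  have hplate : ¬ (z0 = 0 ∨ z0 = 1) := fun h => by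
    have : zeroExt T (t0, x0, y0, z0) = 0 := by
      rw [zeroExt_eq_ev _ hl]
      exact hT.mem _ h
    simp only [g, this] at hneg
    linarith
  push Not at hplate
  have hz1 : 0 < z0 := lt_of_le_of_ne hz0.1 (Ne.symm hplate.1)
  have hz2 : z0 < 1 := lt_of_le_of_ne hz0.2 hplate.2
  have mx : IsLocalMin (fun x => zeroExt T (t0, x, y0, z0)) x0 :=
    Filter.Eventually.of_forall fun x => by
      have := hmin' t0 x y0 z0 ht0 hz0
      simpa [g] using this
  have my : IsLocalMin (fun y => zeroExt T (t0, x0, y, z0)) y0 :=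
    Filter.Eventually.of_forall fun y => by
      have := hmin' t0 x0 y z0 ht0 hz0
      simpa [g] using this
  have mz : IsLocalMin (fun z => zeroExt T (t0, x0, y0, z)) z0 := by
    filter_upwards [Icc_mem_nhds hz1 hz2] with z hz
    have := hmin' t0 x0 y0 z ht0 hz
    simpa [g] using this
  have dzz : ∀ F : LayerFunctions Lx Ly, ∀ z ∈ Set.Ioo (0 : ℝ) 1,
      HasDerivAt (fun z => zeroExt F (t0, x0, y0, z))
        (zeroExt (Dz F : LayerFunctions Lx Ly) (t0, x0, y0, z)) z := fun F z hz =>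
    (hasDerivWithinAt_z F (t := t0) (x := x0) (y := y0) (z := z)
      ⟨hl.1, Set.Ioo_subset_Icc_self hz⟩).hasDerivAt
      (Icc_mem_nhds hz.1 hz.2)
  have gx := mx.hasDerivAt_eq_zero (hasDerivAt_x T hl)
  have gy := my.hasDerivAt_eq_zero (hasDerivAt_y T hl)
  have gz := mz.hasDerivAt_eq_zero (dzz T z0 ⟨hz1, hz2⟩)
  have lx := second_deriv_nonneg_of_isLocalMin mx
    (Filter.Eventually.of_forall fun x => hasDerivAt_x T (t := t0) (x := x) hl)
    (hasDerivAt_x (Dx T) hl)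
  have ly := second_deriv_nonneg_of_isLocalMin my
    (Filter.Eventually.of_forall fun y => hasDerivAt_y T (t := t0) (y := y) hl)
    (hasDerivAt_y (Dy T) hl)
  have lz := second_deriv_nonneg_of_isLocalMin mz
    (Filter.eventually_of_mem (Ioo_mem_nhds hz1 hz2) fun z hz => dzz T z hz)
    (dzz (Dz T) z0 ⟨hz1, hz2⟩)
  -- The minimum may sit at the final time `b`, so only earlier times are used.
  have lt := deriv_nonpos_of_min_on_left hat
    ((hasDerivAt_t T hl).add (((hasDerivAt_id t0).sub_const a).const_mul s |>.const_sub M))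
    (fun r hr => hmin' r x0 y0 z0 ⟨hr.1.le, hr.2.le.trans ht0.2⟩ hz0)
  have heq := congrArg (ev ⟨_, hl⟩) hT.eq
  rw [zeroExt_eq_ev _ hl] at gx gy gz lx ly lz lt
  simp only [map_add, map_mul, map_one, gx, gy, gz] at heq
  linarith

/-- The temperature is nonnegative after a finite time: the lower bound at time `1` improves at rate
`1/2` until it reaches zero, and zero is then preserved. -/
lemma IsHeated.eventually_nonneg (hT : IsHeated u v w T) :
    ∃ t₂, 1 ≤ t₂ ∧ ∀ q : layer, t₂ ≤ q.1.1 → 0 ≤ ev q T := by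
  let K : Set SpaceTime := {1} ×ˢ (Set.Icc 0 Lx ×ˢ (Set.Icc 0 Ly ×ˢ Set.Icc (0 : ℝ) 1))
  have hK : IsCompact K :=
    isCompact_singleton.prod (isCompact_Icc.prod (isCompact_Icc.prod isCompact_Icc))
  have hKl : K ⊆ layer := fun q hq => ⟨by rw [show q.1 = 1 from hq.1]; exact one_pos, hq.2.2.2⟩
  obtain ⟨m, hm⟩ := (hK.image_of_continuousOn
    ((contDiffOn_zeroExt T).continuousOn.mono hKl)).bddBelow
  have h1 : ∀ x y z, z ∈ Set.Icc (0 : ℝ) 1 → m ≤ zeroExt T (1, x, y, z) := by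
    intro x y z hz
    obtain ⟨x', hx', y', hy', e⟩ := exists_fundamental_domain T 1 x y z
    rw [e]
    exact hm ⟨(1, x', y', z), ⟨rfl, hx', hy', hz⟩, rfl⟩
  set M := |m| with hM
  have hM0 : 0 ≤ M := abs_nonneg m
  have h2 : ∀ x y z, z ∈ Set.Icc (0 : ℝ) 1 → 0 ≤ zeroExt T (1 + 2 * M, x, y, z) := by
    intro x y z hz
    have := hT.lower_bound (a := 1) (b := 1 + 2 * M) (s := 1 / 2) (M := M) one_pos (by norm_num)
      (by norm_num) (by linarith)
      (fun x y z hz => (neg_abs_le m).trans (h1 x y z hz)) (t := 1 + 2 * M) (x := x) (y := y)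
      (z := z) ⟨by linarith, le_rfl⟩ hz
    linarith
  refine ⟨1 + 2 * M, by linarith, fun q hq => ?_⟩
  have := hT.lower_bound (a := 1 + 2 * M) (b := q.1.1) (s := 0) (M := 0) (by linarith) le_rfl
    one_pos (by simp) (fun x y z hz => by simpa using h2 x y z hz) (t := q.1.1) (x := q.1.2.1)
    (y := q.1.2.2.1) (z := q.1.2.2.2) ⟨hq, le_rfl⟩ q.2.2
  rw [zeroExt_eq_ev _ q.2] at this
  simpa using this

end

/-! ### Balance laws for the temperature -/

/-- The flow is incompressible and does not cross the plates. -/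
structure IsSolenoidal (u v w : LayerFunctions Lx Ly) : Prop where
  mem : w ∈ platesIdeal Lx Ly
  eq : Dx u + Dy v + Dz w = 0

lemma hmean_mul_of_eq {ψ : LayerFunctions Lx Ly} {c z : ℝ} (hz : z ∈ Set.Icc (0 : ℝ) 1)
    (hψ : ∀ q, height q = z → ev q ψ = c) (F : LayerFunctions Lx Ly) (t : ℝ) :
    hmean (ψ * F) t z = c * hmean F t z := by
  rcases le_or_gt t 0 with ht | ht
  · simp [hmean_of_nonpos _ ht]
  rw [← hmean_smul]
  refine hmean_congr fun x y => ?_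
  rw [zeroExt_eq_ev _ (q := (t, x, y, z)) ⟨ht, hz⟩, zeroExt_eq_ev _ (q := (t, x, y, z)) ⟨ht, hz⟩,
    map_mul, map_smul, hψ _ rfl, smul_eq_mul]

lemma avg_Dz_of_eq [Fact (0 < Lx)] [Fact (0 < Ly)] {ψ : LayerFunctions Lx Ly} {c₀ c₁ t : ℝ}
    (ht : 0 < t) (h0 : ∀ q, height q = 0 → ev q ψ = c₀) (h1 : ∀ q, height q = 1 → ev q ψ = c₁) :
    avg t (Dz ψ) = c₁ - c₀ := by
  have e := fun (z c : ℝ) hz hψ => hmean_mul_of_eq (ψ := ψ) (z := z) (c := c) hz hψ (cst 1) t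
  have z0 : (0 : ℝ) ∈ Set.Icc (0 : ℝ) 1 := by simp
  have z1 : (1 : ℝ) ∈ Set.Icc (0 : ℝ) 1 := by simp
  have e0 := e 0 c₀ z0 h0
  have e1 := e 1 c₁ z1 h1
  rw [hmean_algebraMap 1 ht z0] at e0
  rw [hmean_algebraMap 1 ht z1] at e1
  rw [cst, map_one, mul_one] at e0 e1
  rw [avg_Dz, e0, e1, mul_one, mul_one]

namespace IsHeated

variable {u v w T : LayerFunctions Lx Ly}

/-- The temperature equation tested with a function `ψ` of the height that vanishes at the top. -/
lemma avg_Dt_mul (hT : IsHeated u v w T) (hu : IsSolenoidal u v w) {ψ : LayerFunctions Lx Ly}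
    {κ : ℝ} (ht : Dt ψ = 0) (hx : Dx ψ = 0) (hy : Dy ψ = 0) (h0 : ∀ q, height q = 0 → ev q ψ = κ)
    (h1 : ∀ q, height q = 1 → ev q ψ = 0) (t : ℝ) :
    avg t (Dt (ψ * T)) = avg t ψ + avg t (Dz ψ * (w * T)) + avg t (Dz (Dz ψ) * T)
      - κ * hmean (Dz T) t 0 := by
  have e : avg t (Dt (ψ * T) - ψ - Dz ψ * (w * T) - Dz (Dz ψ) * T - Dz (ψ * Dz T)) = 0 := by
    refine avg_eq_zero_of_divergence (P := ψ * Dx T - ψ * u * T) (Q := ψ * Dy T - ψ * v * T)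
      (S := -(Dz ψ * T) - ψ * w * T) ?_ ?_ t
    · exact sub_mem (neg_mem (Ideal.mul_mem_left _ _ hT.mem)) (Ideal.mul_mem_left _ _ hT.mem)
    · simp only [map_sub, map_neg, partialD_mul, ht, hx, hy]
      linear_combination ψ * hT.eq + ψ * T * hu.eq
  simp only [map_sub] at e
  rw [avg_Dz t (ψ * Dz T), hmean_mul_of_eq (by simp) h0, hmean_mul_of_eq (by simp) h1] at e
  linarith

variable [Fact (0 < Lx)] [Fact (0 < Ly)]

lemma avg_transport (hT : IsHeated u v w T) (hu : IsSolenoidal u v w) {t : ℝ} (ht : 0 < t) :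
    avg t (w * T) = 1 / 2 - hmean (Dz T) t 0 - avg t (Dt ((1 - zc) * T)) := by
  have hz : Dz (1 - zc : LayerFunctions Lx Ly) = -1 := by
    rw [map_sub, Dz_zc, Derivation.map_one_eq_zero, zero_sub]
  have e := hT.avg_Dt_mul hu (ψ := 1 - zc) (κ := 1)
    (by rw [map_sub, Dt_zc, Derivation.map_one_eq_zero, sub_zero])
    (by rw [map_sub, Dx_zc, Derivation.map_one_eq_zero, sub_zero])
    (by rw [map_sub, Dy_zc, Derivation.map_one_eq_zero, sub_zero])
    (fun q hq => by rw [map_sub, map_one, ev_zc, hq, sub_zero])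
    (fun q hq => by rw [map_sub, map_one, ev_zc, hq, sub_self]) t
  have e1 := avg_Dz_of_eq (ψ := (1 - zc : LayerFunctions Lx Ly) ^ 2) (c₀ := 1) (c₁ := 0) ht
    (fun q hq => by rw [map_pow, map_sub, map_one, ev_zc, hq]; norm_num)
    (fun q hq => by rw [map_pow, map_sub, map_one, ev_zc, hq]; norm_num)
  have e2 : Dz ((1 - zc : LayerFunctions Lx Ly) ^ 2) = -(2 * (1 - zc)) := by
    rw [partialD_pow_two, hz]
    ring
  rw [e2, map_neg, avg_ofNat_mul] at e1
  have e3 : (-1 : LayerFunctions Lx Ly) * (w * T) = -(w * T) := by ring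
  simp only [hz, e3, map_neg, Derivation.map_one_eq_zero, one_mul, neg_zero, zero_mul,
    map_zero] at e
  linarith

/-- The energy balance, in the form of a bound for the dissipation. -/
lemma dissipation_bound (hT : IsHeated u v w T) (hu : IsSolenoidal u v w) {t : ℝ} (ht : 0 < t) :
    avg t (Dx T ^ 2) + avg t (Dy T ^ 2) + avg t (Dz T ^ 2) ≤ 1 / 12 - avg t (Dt (T ^ 2)) := by
  have e : avg t (Dt (T ^ 2) + 2 * Dx T ^ 2 + 2 * Dy T ^ 2 + 2 * Dz T ^ 2 - 2 * T) = 0 := by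
    refine avg_eq_zero_of_divergence (P := 2 * (T * Dx T) - u * T ^ 2)
      (Q := 2 * (T * Dy T) - v * T ^ 2) (S := 2 * (T * Dz T) - w * T ^ 2) ?_ ?_ t
    · exact sub_mem (Ideal.mul_mem_left _ _ (Ideal.mul_mem_right _ _ hT.mem))
        (Ideal.mul_mem_right _ _ hu.mem)
    · simp only [map_sub, partialD_mul, partialD_pow_two, partialD_ofNat]
      linear_combination 2 * T * hT.eq + T ^ 2 * hu.eq
  set a : LayerFunctions Lx Ly := zc - cst (1 / 2) with ha
  have hz : Dz a = 1 := by rw [ha, map_sub, Dz_zc, partialD_cst, sub_zero]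
  have e1 : avg t (T + a * Dz T) = 0 := by
    refine avg_eq_zero_of_divergence (P := 0) (Q := 0) (S := a * T)
      (Ideal.mul_mem_left _ _ hT.mem) ?_ t
    rw [partialD_mul, hz, map_zero, map_zero]
    ring
  have e2 := avg_Dz_of_eq (ψ := a * a ^ 2) (c₀ := -1 / 8) (c₁ := 1 / 8) ht
    (fun q hq => by rw [map_mul, map_pow, ha, map_sub, ev_cst, ev_zc, hq]; norm_num)
    (fun q hq => by rw [map_mul, map_pow, ha, map_sub, ev_cst, ev_zc, hq]; norm_num)
  have e3 : Dz (a * a ^ 2) = 3 * a ^ 2 := by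
    rw [partialD_mul, partialD_pow_two, hz]
    ring
  rw [e3, avg_ofNat_mul] at e2
  have e4 := avg_sq_nonneg t (Dz T + a)
  have e5 : (Dz T + a) ^ 2 = Dz T ^ 2 + 2 * (a * Dz T) + a ^ 2 := by ring
  rw [e5] at e4
  have n1 := avg_sq_nonneg t (Dx T)
  have n2 := avg_sq_nonneg t (Dy T)
  simp only [map_add, map_sub, avg_ofNat_mul] at e e1 e4
  linarith

lemma bottom_flux_nonneg (hT : IsHeated u v w T) {t : ℝ} (ht : 0 < t)
    (hpos : ∀ q : layer, q.1.1 = t → 0 ≤ ev q T) : 0 ≤ hmean (Dz T) t 0 := by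
  refine hmean_nonneg fun x y => ?_
  have hl : ∀ z ∈ Set.Icc (0 : ℝ) 1, (t, x, y, z) ∈ layer := fun z hz => ⟨ht, hz⟩
  have h0 : (0 : ℝ) ∈ Set.Icc (0 : ℝ) 1 := by simp
  have h := (hasDerivWithinAt_z T (hl 0 h0)).mono Set.Ioo_subset_Icc_self
  have h' := (hasDerivWithinAt_iff_tendsto_slope' (by simp)).1 h
  have : (nhdsWithin (0 : ℝ) (Set.Ioo 0 1)).NeBot :=
    mem_closure_iff_nhdsWithin_neBot.1 (by rw [closure_Ioo zero_ne_one]; exact h0)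
  refine ge_of_tendsto h' ?_
  filter_upwards [self_mem_nhdsWithin] with z hz
  rw [slope_def_field, zeroExt_eq_ev T (hl 0 h0),
    zeroExt_eq_ev T (hl z (Set.Ioo_subset_Icc_self hz)),
    hT.mem ⟨_, hl 0 h0⟩ (Or.inl rfl), sub_zero, sub_zero]
  exact div_nonneg (hpos _ rfl) hz.1.le

end IsHeated

variable {u v w T : LayerFunctions Lx Ly}

/-- The test function `δ³ / (z + δ)³ - δ³ / (1 + δ)³`: convex, decreasing from nearly one at the
bottom plate, where it has a boundary layer of width `δ`, to zero at the top plate. -/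
def profile (δ : ℝ) (hδ : 0 < δ) : LayerFunctions Lx Ly :=
  cst (δ ^ 3) * (bw δ hδ ^ 3 - cst ((1 + δ)⁻¹ ^ 3))

section profile

variable {δ : ℝ} {hδ : 0 < δ}

lemma ev_profile (q : layer) : ev q (profile δ hδ : LayerFunctions Lx Ly) =
    δ ^ 3 * ((height q + δ)⁻¹ ^ 3 - (1 + δ)⁻¹ ^ 3) := by
  simp only [profile, map_mul, map_sub, map_pow, ev_cst, ev_bw]

lemma ev_profile_mem (q : layer) :
    ev q (profile δ hδ : LayerFunctions Lx Ly) ∈ Set.Icc (0 : ℝ) 1 := by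
  rw [ev_profile]
  have h0 := height_nonneg q
  have h1 := height_le_one q
  have h2 : (1 + δ)⁻¹ ≤ (height q + δ)⁻¹ := by gcongr
  have h3 : (1 + δ)⁻¹ ^ 3 ≤ (height q + δ)⁻¹ ^ 3 := by gcongr
  have h4 : δ * (height q + δ)⁻¹ ≤ 1 := by
    rw [← div_eq_mul_inv]
    exact div_le_one_of_le₀ (by linarith) (by linarith)
  have h5 : δ ^ 3 * (height q + δ)⁻¹ ^ 3 ≤ 1 := by
    rw [← mul_pow]
    exact pow_le_one₀ (by positivity) h4
  have h6 : 0 ≤ δ ^ 3 * (1 + δ)⁻¹ ^ 3 := by positivity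
  exact ⟨mul_nonneg (by positivity) (sub_nonneg.2 h3), by linarith⟩

lemma Dz_profile : Dz (profile δ hδ : LayerFunctions Lx Ly) =
    - (cst (3 * δ ^ 3) * bw δ hδ ^ 4) := by
  simp only [profile, map_sub, partialD_mul, partialD_cst, pow_succ, pow_zero, one_mul, Dz_bw]
  simp only [cst, map_mul, map_ofNat]
  ring

lemma Dz_Dz_profile : Dz (Dz (profile δ hδ : LayerFunctions Lx Ly)) =
    cst (12 * δ ^ 3) * bw δ hδ ^ 5 := by
  rw [Dz_profile]
  simp only [map_neg, partialD_mul, partialD_cst, pow_succ, pow_zero, one_mul, Dz_bw]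
  simp only [cst, map_mul, map_ofNat]
  ring

lemma avg_profile [Fact (0 < Lx)] [Fact (0 < Ly)] {t : ℝ} (ht : 0 < t) :
    δ / 2 - 3 / 2 * δ ^ 3 ≤ avg t (profile δ hδ : LayerFunctions Lx Ly) := by
  have h1 := avg_Dz_of_eq (ψ := (bw δ hδ : LayerFunctions Lx Ly) ^ 2) (c₀ := δ⁻¹ ^ 2)
    (c₁ := (1 + δ)⁻¹ ^ 2) ht
    (fun q hq => by rw [map_pow, ev_bw, hq, zero_add]) (fun q hq => by rw [map_pow, ev_bw, hq])
  have h2 : Dz ((bw δ hδ : LayerFunctions Lx Ly) ^ 2) = -(2 * bw δ hδ ^ 3) := by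
    rw [partialD_pow_two, Dz_bw]
    ring
  rw [h2, map_neg, avg_ofNat_mul] at h1
  rw [profile, avg_cst_mul, map_sub, avg_algebraMap _ ht]
  have hs : (1 + δ)⁻¹ ≤ 1 := inv_le_one_of_one_le₀ (by linarith)
  have hs0 : 0 ≤ (1 + δ)⁻¹ := by positivity
  have hs2 : (1 + δ)⁻¹ ^ 2 ≤ 1 := pow_le_one₀ hs0 hs
  have hs3 : (1 + δ)⁻¹ ^ 3 ≤ 1 := pow_le_one₀ hs0 hs
  have h3 : δ ^ 3 * δ⁻¹ ^ 2 = δ := by field_simp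
  have h4 : avg t ((bw δ hδ : LayerFunctions Lx Ly) ^ 3) =
      δ⁻¹ ^ 2 / 2 - (1 + δ)⁻¹ ^ 2 / 2 := by linarith
  have hδ3 : 0 < δ ^ 3 := by positivity
  rw [h4]
  nlinarith

end profile

/-- The instantaneous bottom heat flux is bounded below, up to a time derivative, as long as the
temperature is nonnegative. The boundary layer width is `δ = ε² = R^{-2/3}`. -/
lemma bottom_flux_bound [Fact (0 < Lx)] [Fact (0 < Ly)] {R ε : ℝ} (hε : 0 < ε) (hεR : ε ^ 3 * R = 1)
    (hT : IsHeated u v w T) (hu : IsSolenoidal u v w) (hw : IsBiharmonic R w T) {t : ℝ}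
    (ht : 0 < t) (hpos : ∀ q : layer, q.1.1 = t → 0 ≤ ev q T) :
    43 / 200 * ε ^ 2 - 3 / 2 * ε ^ 6 + avg t (Dt (cst (171 / 50 * ε ^ 2) * T ^ 2
      - profile (ε ^ 2) (by positivity) * T)) ≤ hmean (Dz T) t 0 := by
  have hδ : 0 < ε ^ 2 := by positivity
  have hR : 0 < R := by
    by_contra h
    have : ε ^ 3 * R ≤ 0 := mul_nonpos_of_nonneg_of_nonpos (by positivity) (not_lt.1 h)
    linarith
  set ψ : LayerFunctions Lx Ly := profile (ε ^ 2) hδ with hψ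
  have hflat : ∀ d : SpaceTime, d.2.2.2 = 0 → partialD d ψ = 0 := fun d hd => by
    simp only [hψ, profile, map_sub, partialD_mul, partialD_cst, pow_succ, pow_zero, one_mul,
      partialD_bw, hd]
    simp
  have e := hT.avg_Dt_mul hu (ψ := ψ) (κ := 1 - (ε ^ 2) ^ 3 * (1 + ε ^ 2)⁻¹ ^ 3) (hflat _ rfl)
    (hflat _ rfl) (hflat _ rfl)
    (fun q hq => by
      rw [hψ, ev_profile, hq, zero_add, mul_sub, ← mul_pow, mul_inv_cancel₀ hδ.ne', one_pow])
    (fun q hq => by rw [hψ, ev_profile, hq, sub_self, mul_zero]) t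
  have p0 : ∀ q : layer, q.1.1 = t → 0 ≤ ev q (Dz (Dz ψ) * T) := fun q hq => by
    rw [hψ, Dz_Dz_profile, map_mul, map_mul, map_pow, ev_cst]
    have := hpos q hq
    have := ev_bw_pos (Lx := Lx) (Ly := Ly) (hδ := hδ) q
    positivity
  have p0' : 0 ≤ avg t (Dz (Dz ψ) * T) := avg_nonneg p0
  have p1 := avg_profile (Lx := Lx) (Ly := Ly) (hδ := hδ) ht
  have p2 := hT.bottom_flux_nonneg ht hpos
  -- The profile is slightly less than one at the bottom plate; as the flux there is nonnegative,
  -- replacing that value by one only weakens the bound.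
  have p3 : 0 ≤ (ε ^ 2) ^ 3 * (1 + ε ^ 2)⁻¹ ^ 3 * hmean (Dz T) t 0 := by positivity
  have p4 := hw.transport_bound (hδ := hδ) hT.mem hR rfl t
  have p5 := hT.dissipation_bound hu ht
  rw [← hψ] at p1
  have q1 : avg t (Dz ψ * (w * T)) = -(3 * (ε ^ 2) ^ 3 *
      avg t (bw (ε ^ 2) hδ ^ 4 * (w * T))) := by
    rw [hψ, Dz_profile, ← avg_cst_mul, ← map_neg]
    congr 1
    ring
  have q2 : Dt (cst (171 / 50 * ε ^ 2) * T ^ 2 - ψ * T) =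
      cst (171 / 50 * ε ^ 2) * Dt (T ^ 2) - Dt (ψ * T) := by
    rw [map_sub, partialD_mul (1, 0, 0, 0) (cst _), partialD_cst, mul_zero, add_zero]
  rw [q2, map_sub, avg_cst_mul]
  set N := avg t (Dx T ^ 2) + avg t (Dy T ^ 2) + avg t (Dz T ^ 2) with hN
  set I := avg t (bw (ε ^ 2) hδ ^ 4 * (w * T)) with hI
  have r1 : 3 * (ε ^ 2) ^ 3 * I ≤ 171 / 50 * ε ^ 2 * N := by
    have := mul_le_mul_of_nonneg_left p4 (show 0 ≤ 3 / 50 * ε ^ 5 by positivity)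
    calc 3 * (ε ^ 2) ^ 3 * I = 3 / 50 * ε ^ 5 * (50 * (ε * I)) := by ring
      _ ≤ 3 / 50 * ε ^ 5 * (57 * R * N) := this
      _ = 171 / 50 * ε ^ 2 * N * (ε ^ 3 * R) := by ring
      _ = _ := by rw [hεR, mul_one]
  have r2 := mul_le_mul_of_nonneg_left p5 (show 0 ≤ 171 / 50 * ε ^ 2 by positivity)
  have r3 : (ε ^ 2) ^ 3 = ε ^ 6 := by ring
  rw [r3] at p1 q1 r1 p3 e
  linarith

/-! ### Infinite-time averages -/

/-- A lower bound `ℓ` for the integrals of `g` up to the increments of a function that is bounded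
below gives any smaller bound for the long-time averages of `g`. -/
lemma eventually_le_timeAverage {g H : ℝ → ℝ} {t₂ ℓ ℓ' K : ℝ}
    (h0 : IntervalIntegrable g MeasureTheory.volume 0 t₂)
    (h1 : ∀ τ, t₂ ≤ τ → IntervalIntegrable g MeasureTheory.volume t₂ τ)
    (h2 : ∀ τ, t₂ ≤ τ → ℓ * (τ - t₂) + (H τ - H t₂) ≤ ∫ t in t₂..τ, g t)
    (hH : ∀ τ, t₂ ≤ τ → -K ≤ H τ) (hℓ : ℓ' < ℓ) :
    ∀ᶠ τ in Filter.atTop, ℓ' ≤ (1 / τ) * ∫ t in (0 : ℝ)..τ, g t := by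
  set c := -((∫ t in (0 : ℝ)..t₂, g t) - ℓ * t₂ - K - H t₂) with hc
  filter_upwards [Filter.eventually_ge_atTop t₂, Filter.eventually_gt_atTop 0,
    Filter.eventually_ge_atTop (c / (ℓ - ℓ'))] with τ k1 k2 k3
  have e := intervalIntegral.integral_add_adjacent_intervals h0 (h1 τ k1)
  have k4 : c ≤ τ * (ℓ - ℓ') := (div_le_iff₀ (sub_pos.2 hℓ)).1 k3
  rw [one_div, inv_mul_eq_div, le_div_iff₀ k2, ← e]
  have := h2 τ k1
  have := hH τ k1
  linarith

lemma le_timeMean {g : ℝ → ℝ} {c : ℝ}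
    (h : ∀ᶠ τ in Filter.atTop, c ≤ (1 / τ) * ∫ t in (0 : ℝ)..τ, g t) :
    (c : EReal) ≤ timeMean g :=
  Filter.le_limsup_of_frequently_le (h.mono fun τ hτ => EReal.coe_le_coe_iff.2 hτ).frequently

lemma timeMean_le {g : ℝ → ℝ} {c : ℝ}
    (h : ∀ᶠ τ in Filter.atTop, (1 / τ) * ∫ t in (0 : ℝ)..τ, g t ≤ c) :
    timeMean g ≤ (c : EReal) :=
  Filter.limsup_le_of_le (h := h.mono fun τ hτ => EReal.coe_le_coe_iff.2 hτ)

/-! ### The constants at large Rayleigh number -/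

lemma n₁_le : n₁ ≤ 1 / 5 := by
  have h1 : (6 : ℝ) ≤ √41 := Real.le_sqrt_of_sq_le (by norm_num)
  have h2 : √41 ≤ 7 := Real.sqrt_le_iff.2 (by norm_num)
  have h3 : ((98 / 9) * (7 - √41)) ^ (1 / 3 : ℝ) ≤ ((12 / 5 : ℝ) ^ 3) ^ (1 / 3 : ℝ) :=
    Real.rpow_le_rpow (by nlinarith) (by nlinarith) (by norm_num)
  rw [← Real.rpow_natCast, ← Real.rpow_mul (by norm_num)] at h3
  norm_num at h3
  rw [n₁]
  linarith

lemma n₁_nonneg : 0 ≤ n₁ := by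
  have h2 : √41 ≤ 7 := Real.sqrt_le_iff.2 (by norm_num)
  have : 0 ≤ (98 / 9) * (7 - √41) := by nlinarith
  rw [n₁]
  positivity

lemma n₃_nonneg : 0 ≤ n₃ := by
  have := n₁_nonneg
  rw [n₃]
  positivity

lemma n₂_nonneg : 0 ≤ n₂ := by
  have := n₃_nonneg
  rw [n₂]
  positivity

/-- For large `R` the claimed bound is dominated by its leading term `n₁ R^{-2/3}`, which lies
below the bound that the argument gives. -/
lemma eventually_fluxLowerBound_lt : ∀ᶠ R : ℝ in Filter.atTop,
    0 < 1 - n₃ * R ^ (-(1 / 3) : ℝ) ∧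
    fluxLowerBound R < 43 / 200 * (R ^ (-(1 / 3) : ℝ)) ^ 2 - 3 / 2 * (R ^ (-(1 / 3) : ℝ)) ^ 6 := by
  have ht : Filter.Tendsto (fun R : ℝ => R ^ (-(1 / 6) : ℝ)) Filter.atTop (nhds 0) :=
    tendsto_rpow_neg_atTop (by norm_num)
  have hev : ∀ c : ℝ, 0 < c → ∀ᶠ R : ℝ in Filter.atTop, R ^ (-(1 / 6) : ℝ) < c := fun c hc =>
    ht.eventually (gt_mem_nhds hc)
  have a2 := n₂_nonneg
  have a3 := n₃_nonneg
  filter_upwards [hev (1 / (2 * (n₃ + 1))) (by positivity),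
    hev (1 / (1000 * (n₂ * n₃ + 1))) (by positivity), hev (1 / 10) (by norm_num),
    Filter.eventually_gt_atTop 0] with R h1 h2 h3 hR
  set η := R ^ (-(1 / 6) : ℝ) with hη
  have hη0 : 0 < η := Real.rpow_pos_of_pos hR _
  have pow_eq : ∀ n : ℕ, η ^ n = R ^ (-(1 / 6) * n : ℝ) := fun n => by
    rw [hη, ← Real.rpow_natCast, ← Real.rpow_mul hR.le]
  have e1 : R ^ (-(1 / 3) : ℝ) = η ^ 2 := by rw [pow_eq]; norm_num
  have e2 : R ^ (-(1 / 2) : ℝ) = η ^ 3 := by rw [pow_eq]; norm_num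
  have e3 : R ^ (-(2 / 3) : ℝ) = η ^ 4 := by rw [pow_eq]; norm_num
  rw [fluxLowerBound, e1, e2, e3]
  rw [lt_div_iff₀ (by positivity)] at h1 h2
  have b1 : n₃ * η ^ 2 ≤ 1 / 2 := by nlinarith
  have b2 : n₂ * n₃ * η ≤ 1 / 1000 := by nlinarith
  have hx0 : 0 ≤ n₃ * η ^ 2 := by positivity
  have hpos : 0 < 1 - n₃ * η ^ 2 := by linarith
  refine ⟨hpos, ?_⟩
  have hlog : -(2 * (n₃ * η ^ 2)) ≤ Real.log (1 - n₃ * η ^ 2) := by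
    have k1 := Real.one_sub_inv_le_log_of_pos hpos
    have k2 : (1 - n₃ * η ^ 2)⁻¹ ≤ 1 + 2 * (n₃ * η ^ 2) := by
      rw [inv_le_iff_one_le_mul₀ hpos]
      nlinarith
    linarith
  have c1 : -(n₂ * η ^ 3 * Real.log (1 - n₃ * η ^ 2)) ≤ 1 / 500 * η ^ 4 := by
    have k1 := mul_le_mul_of_nonneg_left hlog (show 0 ≤ n₂ * η ^ 3 by positivity)
    have k2 := mul_le_mul_of_nonneg_right b2 (show 0 ≤ η ^ 4 by positivity)
    nlinarith
  have c2 : n₁ * η ^ 4 ≤ 1 / 5 * η ^ 4 := by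
    have := n₁_le
    gcongr
  have c3 : (η ^ 2) ^ 6 ≤ 1 / 1000 * η ^ 4 := by
    have : η ^ 8 ≤ (1 / 10) ^ 8 := by gcongr
    have k2 := mul_le_mul_of_nonneg_right this (show 0 ≤ η ^ 4 by positivity)
    have : (η ^ 2) ^ 6 = η ^ 8 * η ^ 4 := by ring
    nlinarith [pow_pos hη0 4]
  have c4 : (η ^ 2) ^ 2 = η ^ 4 := by ring
  rw [c4]
  have := pow_pos hη0 4
  linarith

/-! ### Solutions in the algebra of layer functions -/

lemma eq_of_forall_zeroExt {F G : LayerFunctions Lx Ly}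
    (h : ∀ t x y z : ℝ, (t, x, y, z) ∈ layer → zeroExt F (t, x, y, z) = zeroExt G (t, x, y, z)) :
    F = G := by
  ext ⟨⟨t, x, y, z⟩, hq⟩
  have := h t x y z hq
  rwa [zeroExt_of_mem _ hq, zeroExt_of_mem _ hq] at this

lemma Represents.mem_platesIdeal {F : LayerFunctions Lx Ly} {f : ScalarField}
    (h : Represents F f) (hf : VanishesOnPlates f) : F ∈ platesIdeal Lx Ly := by
  rintro ⟨⟨t, x, y, z⟩, hq⟩ hz
  rw [← zeroExt_eq_ev, ← h t x y z hq]
  rcases hz with hz | hz <;> simp only [height] at hz <;> subst hz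
  · exact (hf t x y hq.1).1
  · exact (hf t x y hq.1).2

/-- Eliminating the pressure from the Stokes equations. -/
lemma isBiharmonic_of_stokes {R : ℝ} {u v w p T : LayerFunctions Lx Ly}
    (hu : u ∈ platesIdeal Lx Ly) (hv : v ∈ platesIdeal Lx Ly) (hw : w ∈ platesIdeal Lx Ly)
    (hdiv : Dx u + Dy v + Dz w = 0)
    (h1 : Dx p = Dx (Dx u) + Dy (Dy u) + Dz (Dz u))
    (h2 : Dy p = Dx (Dx v) + Dy (Dy v) + Dz (Dz v))
    (h3 : Dz p = Dx (Dx w) + Dy (Dy w) + Dz (Dz w) + cst R * T) : IsBiharmonic R w T where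
  mem := hw
  Dz_mem := by
    have : Dz w = -(Dx u) - Dy v := by linear_combination hdiv
    rw [this]
    exact sub_mem (neg_mem (Dx_mem_platesIdeal hu)) (Dy_mem_platesIdeal hv)
  eq := by
    have a1 := congrArg Dz (congrArg Dx h1)
    have a2 := congrArg Dz (congrArg Dy h2)
    have a3 := congrArg Dx (congrArg Dx h3)
    have a4 := congrArg Dy (congrArg Dy h3)
    have d1 := congrArg Dz (congrArg Dx (congrArg Dx hdiv))
    have d2 := congrArg Dz (congrArg Dy (congrArg Dy hdiv))
    have d3 := congrArg Dz (congrArg Dz (congrArg Dz hdiv))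
    simp only [map_add, map_zero, partialD_mul, partialD_cst, mul_zero, add_zero]
      at a1 a2 a3 a4 d1 d2 d3
    simp only [Dz_Dx, Dz_Dy, Dy_Dx] at a1 a2 a3 a4 d1 d2 d3 ⊢
    linear_combination a1 + a2 - a3 - a4 + d1 + d2 + d3

/-! ### The bounds for the infinite-time averages -/

/-- Completing the square: a functional `⟨C T² + φ T⟩` with `C > 0` is bounded below whatever `T`
is, so no a priori bound on the temperature is needed to average in time. -/
lemma avg_quadratic_lower_bound [Fact (0 < Lx)] [Fact (0 < Ly)] {T φ : LayerFunctions Lx Ly}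
    {C t : ℝ} (hC : 0 < C) (ht : 0 < t) (hφ : ∀ q, ev q φ ^ 2 ≤ 1) :
    -(1 / (4 * C)) ≤ avg t (cst C * T ^ 2 + φ * T) := by
  rw [← avg_algebraMap (Lx := Lx) (Ly := Ly) (-(1 / (4 * C))) ht]
  refine avg_mono_of_ev (fun q => ?_) t
  have h := hφ q
  rw [ev_cst, map_add, map_mul, map_mul, map_pow, ev_cst, ← sub_nonneg]
  have : C * ev q T ^ 2 + ev q φ * ev q T - -(1 / (4 * C)) =
      ((2 * C * ev q T + ev q φ) ^ 2 + (1 - ev q φ ^ 2)) / (4 * C) := by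
    field_simp
    ring
  rw [this]
  have := sub_nonneg.2 h
  positivity

lemma intervalIntegrable_of_continuousOn {g : ℝ → ℝ} (h : ContinuousOn g (Set.Ioi 0)) {a b : ℝ}
    (ha : 0 < a) (hab : a ≤ b) : IntervalIntegrable g MeasureTheory.volume a b :=
  (h.mono fun t ht => by
    rw [Set.uIcc_of_le hab] at ht
    exact ha.trans_le ht.1).intervalIntegrable

lemma intervalIntegrable_avg (F : LayerFunctions Lx Ly) {a b : ℝ} (ha : 0 < a) (hab : a ≤ b) :
    IntervalIntegrable (fun t => avg t F) MeasureTheory.volume a b :=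
  intervalIntegrable_of_continuousOn (continuousOn_avg F) ha hab

/-- Integrated form of a differential inequality. -/
lemma integral_ge_of_ge_avg_Dt {g : ℝ → ℝ} {F : LayerFunctions Lx Ly} {a b ℓ : ℝ} (ha : 0 < a)
    (hab : a ≤ b) (hg : ContinuousOn g (Set.Ioi 0)) (h : ∀ t, a ≤ t → ℓ + avg t (Dt F) ≤ g t) :
    ℓ * (b - a) + (avg b F - avg a F) ≤ ∫ t in a..b, g t := by
  have h1 := intervalIntegral.integral_mono_on hab
    ((intervalIntegrable_const (c := ℓ)).add (intervalIntegrable_avg (Dt F) ha hab))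
    (intervalIntegrable_of_continuousOn hg ha hab) fun t ht => h t ht.1
  rw [intervalIntegral.integral_add intervalIntegrable_const
    (intervalIntegrable_avg (Dt F) ha hab), integral_avg_Dt F ha hab,
    intervalIntegral.integral_const, smul_eq_mul] at h1
  linarith

lemma timeMean_bounds [Fact (0 < Lx)] [Fact (0 < Ly)] {u v w T : LayerFunctions Lx Ly}
    {R ε c : ℝ} (hε : 0 < ε) (hεR : ε ^ 3 * R = 1) (hT : IsHeated u v w T)
    (hu : IsSolenoidal u v w) (hw : IsBiharmonic R w T)
    (hc : c < 43 / 200 * ε ^ 2 - 3 / 2 * ε ^ 6) {f g : ℝ → ℝ}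
    (hf : ∀ t, 0 < t → f t = hmean (Dz T) t 0) (hg : ∀ t, 0 < t → g t = avg t (w * T))
    (hfi : IntervalIntegrable f MeasureTheory.volume 0 1)
    (hgi : IntervalIntegrable g MeasureTheory.volume 0 1) :
    (c : EReal) ≤ timeMean f ∧ timeMean g ≤ ((1 / 2 - c : ℝ) : EReal) := by
  obtain ⟨t₂, ht₂, hpos⟩ := hT.eventually_nonneg
  have ht₂' : 0 < t₂ := by linarith
  set C := 171 / 50 * ε ^ 2 with hC
  have hC0 : 0 < C := by positivity
  set ψ : LayerFunctions Lx Ly := profile (ε ^ 2) (by positivity) with hψ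
  set ℓ := 43 / 200 * ε ^ 2 - 3 / 2 * ε ^ 6 with hℓ
  have hfc : ContinuousOn f (Set.Ioi 0) :=
    (continuousOn_hmean_time (Dz T) (by simp)).congr fun t ht => hf t ht
  have hgc : ContinuousOn g (Set.Ioi 0) := (continuousOn_avg (w * T)).congr fun t ht => hg t ht
  have hflux : ∀ t, t₂ ≤ t → ℓ + avg t (Dt (cst C * T ^ 2 - ψ * T)) ≤ f t := fun t ht => by
    rw [hf t (ht₂'.trans_le ht)]
    exact bottom_flux_bound hε hεR hT hu hw (ht₂'.trans_le ht) fun q hq => hpos q (hq ▸ ht)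
  have htrans : ∀ t, t₂ ≤ t →
      (ℓ - 1 / 2) + avg t (Dt (cst C * T ^ 2 - ψ * T + (1 - zc) * T)) ≤ -g t := fun t ht => by
    have h1 := hflux t ht
    have ht0 := ht₂'.trans_le ht
    rw [hf t ht0] at h1
    rw [hg t ht0, hT.avg_transport hu ht0, map_add, map_add]
    linarith
  have hψm : ∀ q, ev q ψ ∈ Set.Icc (0 : ℝ) 1 := fun q => ev_profile_mem q
  constructor
  · refine le_timeMean (eventually_le_timeAverage (t₂ := t₂) (ℓ := ℓ) (K := 1 / (4 * C))
      (H := fun τ => avg τ (cst C * T ^ 2 - ψ * T))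
      (hfi.trans (intervalIntegrable_of_continuousOn hfc one_pos ht₂))
      (fun τ hτ => intervalIntegrable_of_continuousOn hfc ht₂' hτ)
      (fun τ hτ => integral_ge_of_ge_avg_Dt ht₂' hτ hfc hflux) (fun τ hτ => ?_) hc)
    have e : cst C * T ^ 2 - ψ * T = cst C * T ^ 2 + (-ψ) * T := by ring
    rw [e]
    refine avg_quadratic_lower_bound hC0 (ht₂'.trans_le hτ) fun q => ?_
    obtain ⟨k1, k2⟩ := hψm q
    rw [map_neg]
    nlinarith
  · have key := eventually_le_timeAverage (g := fun t => -g t) (t₂ := t₂) (ℓ := ℓ - 1 / 2)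
      (ℓ' := c - 1 / 2) (K := 1 / (4 * C))
      (H := fun τ => avg τ (cst C * T ^ 2 - ψ * T + (1 - zc) * T))
      (hgi.trans (intervalIntegrable_of_continuousOn hgc one_pos ht₂)).neg
      (fun τ hτ => (intervalIntegrable_of_continuousOn hgc ht₂' hτ).neg)
      (fun τ hτ => integral_ge_of_ge_avg_Dt ht₂' hτ hgc.neg htrans) (fun τ hτ => ?_)
      (by linarith)
    · refine timeMean_le (key.mono fun τ hτ => ?_)
      rw [intervalIntegral.integral_neg] at hτ
      linarith
    · have e : cst C * T ^ 2 - ψ * T + (1 - zc) * T = cst C * T ^ 2 + (1 - zc - ψ) * T := by ring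
      rw [e]
      refine avg_quadratic_lower_bound hC0 (ht₂'.trans_le hτ) fun q => ?_
      obtain ⟨k1, k2⟩ := hψm q
      have k3 := height_nonneg q
      have k4 := height_le_one q
      rw [map_sub, map_sub, map_one, ev_zc]
      nlinarith

end IHC
end

theorem mainTheorem1 :
    ∃ R₀ : ℝ, 1 < R₀ ∧ ∀ R : ℝ, R₀ < R →
      0 < 1 - IHC.n₃ * R ^ (-(1 / 3) : ℝ) ∧
      ∀ (Lx Ly : ℝ) (u v w p T : IHC.ScalarField), 0 < Lx → 0 < Ly →
        IHC.IsNoSlipSolution R Lx Ly u v w p T →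
        IntervalIntegrable (IHC.convectiveTransport Lx Ly w T) MeasureTheory.volume 0 1 →
        IntervalIntegrable (IHC.bottomFlux Lx Ly T) MeasureTheory.volume 0 1 →
        ((IHC.fluxLowerBound R : ℝ) : EReal) ≤ IHC.timeMean (IHC.bottomFlux Lx Ly T) ∧
        IHC.timeMean (IHC.convectiveTransport Lx Ly w T)
          ≤ ((1 / 2 - IHC.fluxLowerBound R : ℝ) : EReal) := by
  open IHC in
  obtain ⟨R₁, hR₁⟩ := Filter.eventually_atTop.1 eventually_fluxLowerBound_lt
  refine ⟨max R₁ 2, lt_max_of_lt_right one_lt_two, fun R hR => ?_⟩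
  have hR0 : 0 < R := zero_lt_two.trans ((le_max_right R₁ 2).trans_lt hR)
  obtain ⟨hlog, hbound⟩ := hR₁ R ((le_max_left R₁ 2).trans hR.le)
  refine ⟨hlog, fun Lx Ly u v w p T hLx hLy h hgi hfi => ?_⟩
  have : Fact (0 < Lx) := ⟨hLx⟩
  have : Fact (0 < Ly) := ⟨hLy⟩
  obtain ⟨U, hU⟩ := exists_represents h.smooth_u h.periodic_u
  obtain ⟨V, hV⟩ := exists_represents h.smooth_v h.periodic_v
  obtain ⟨W, hW⟩ := exists_represents h.smooth_w h.periodic_w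
  obtain ⟨P, hP⟩ := exists_represents h.smooth_p h.periodic_p
  obtain ⟨Θ, hΘ⟩ := exists_represents h.smooth_T h.periodic_T
  have hWp := hW.mem_platesIdeal h.noSlip_w
  have hdiv : Dx U + Dy V + Dz W = 0 := eq_of_forall_zeroExt fun t x y z hq => by
    have e := h.incompressible t x y z hq.1 hq.2
    rw [hU.dx t x y z hq, hV.dy t x y z hq, hW.dz t x y z hq] at e
    simpa only [zeroExt_eq_ev _ hq, map_add, map_zero] using e
  have hbih : IsBiharmonic R W Θ := by
    refine isBiharmonic_of_stokes (p := P) (hU.mem_platesIdeal h.noSlip_u)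
      (hV.mem_platesIdeal h.noSlip_v) hWp hdiv ?_ ?_ ?_
    · refine eq_of_forall_zeroExt fun t x y z hq => ?_
      rw [← hP.dx t x y z hq, ← hU.laplacian t x y z hq]
      exact h.momentum_x t x y z hq.1 hq.2
    · refine eq_of_forall_zeroExt fun t x y z hq => ?_
      rw [← hP.dy t x y z hq, ← hV.laplacian t x y z hq]
      exact h.momentum_y t x y z hq.1 hq.2
    · refine eq_of_forall_zeroExt fun t x y z hq => ?_
      have e := h.momentum_z t x y z hq.1 hq.2
      rw [hP.dz t x y z hq, hW.laplacian t x y z hq, hΘ t x y z hq] at e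
      rw [e]
      simp only [zeroExt_eq_ev _ hq, map_add, map_mul, ev_cst]
  have hheat : IsHeated U V W Θ := by
    refine ⟨hΘ.mem_platesIdeal h.isothermal, eq_of_forall_zeroExt fun t x y z hq => ?_⟩
    have e := h.heat t x y z hq.1 hq.2
    rw [hΘ.dt t x y z hq, hU t x y z hq, hV t x y z hq, hW t x y z hq, hΘ.dx t x y z hq,
      hΘ.dy t x y z hq, hΘ.dz t x y z hq, hΘ.laplacian t x y z hq] at e
    simpa only [zeroExt_eq_ev _ hq, map_add, map_mul, map_one] using e
  have hWΘ : Represents (W * Θ) (fun t x y z => w t x y z * T t x y z) := fun t x y z hq => by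
    simp only [hW t x y z hq, hΘ t x y z hq, zeroExt_mul, Pi.mul_apply]
  have hε : (R ^ (-(1 / 3) : ℝ)) ^ 3 * R = 1 := by
    rw [← Real.rpow_natCast, ← Real.rpow_mul hR0.le]
    norm_num
    rw [Real.rpow_neg_one, inv_mul_cancel₀ hR0.ne']
  exact timeMean_bounds (Real.rpow_pos_of_pos hR0 _) hε hheat ⟨hWp, hdiv⟩ hbih hbound
    (fun t ht => hΘ.dz.horAvg_eq ht (by simp)) (fun t ht => hWΘ.volAvg_eq ht) hfi hgi
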